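/- Let $k$ be a non-archimedean local field of characteristic $0$ with residue field of characteristic $p$ and cardinality $q$, let $\bar k$ be an algebraic closure, $\mathcal I\subset\mathrm{Gal}(\bar k/k)$ the inertia group, $\mathcal I^+$ its maximal pro-$p$ subgroup (wild inertia), $\mathrm{Frob}\in \mathrm{Gal}(\bar k/k)$ a fixed geometric Frobenius, $W_k=\mathcal I\rtimes\langle \mathrm{Frob}\rangle$ the Weil group (with $\mathcal I$ open and carrying its profinite topology), and for $m\ge 1$ let $W_{k_m}=\mathcal I\rtimes\langle\mathrm{Frob}^m\rangle$ be the Weil group of the unramified extension $k_m/k$ of degree $m$. For a character $\eta$ of $W_{k_m}$ put $\eta^{\mathrm{Frob}^i}(w)=\eta(\mathrm{Frob}^{-i}w\,\mathrm{Frob}^i)$. A Langlands parameter is a continuous homomorphism $\phi:W_k\times SL_2(\mathbb C)\to GSp_{2n}(\mathbb C)$ with $\phi(\mathrm{Frob})$ semisimple. It is tame if it is trivial on $\mathcal I^+$; regular if the centralizer of $\phi(\mathcal I)$ in $GSp_{2n}(\mathbb C)$ is a maximal torus of $GSp_{2n}(\mathbb C)$; discrete series if the centralizer of $\phi(W_k)$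 in $GSp_{2n}(\mathbb C)$ and the center of $GSp_{2n}(\mathbb C)$ have the same identity component. It has similitude character $\lambda:W_k\to\mathbb C^\times$ if $\langle\phi(w)v,\phi(w)v'\rangle=\lambda(w)\langle v,v'\rangle$ for all $w\in W_k$ and $v,v'\in\mathbb C^{2n}$. **Lemma 3.3.** Let $\phi$ be a tame regular discrete series Langlands parameter into $GSp_{2n}(\mathbb C)$ with similitude character $\lambda$. Then $\phi$ is trivial on $SL_2(\mathbb C)$, and there are integers $d_1,\dots,d_s\ge 1$ with $d_1+\cdots+d_s=n$ and continuous characters $\eta_i:W_{k_{2d_i}}\to\mathbb C^\times$ such that, with $V(\eta_i)=\mathrm{Ind}_{W_{k_{2d_i}}}^{W_k}\eta_i$: 1. for every $i$: $\eta_i$ is trivial on $\mathcal I^+$; the characters $\eta_i,\eta_i^{\mathrm{Frob}},\dots,\eta_i^{\mathrm{Frob}^{2d_i-1}}$ are pairwise distinct; $\eta_i\cdot\eta_i^{\mathrm{Frob}^{d_i}}=\lambda|_{W_{k_{2d_i}}}$; and $\eta_i(\mathrm{Frob}^{2d_i})=-\lambda(\mathrm{Frob}^{d_i})$; 2. every $V(\eta_i)$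 is trivial on $\mathcal I^+$ and irreducible, and carries a nondegenerate alternating form $B_i$ on which $W_k$ acts by similitudes with similitude character $\lambda$; 3. if $i\ne j$ and $d_i=d_j$, then $\eta_i\neq\eta_j^{\mathrm{Frob}^m}$ for all $m\ge 0$; and for all $i\ne j$ the representations $V(\eta_i)$ and $V(\eta_j)$ are not isomorphic; 4. there is a $W_k$-equivariant linear isomorphism $\bigoplus_{i=1}^s V(\eta_i)\cong\mathbb C^{2n}$, where $W_k$ acts on $\mathbb C^{2n}$ through $\phi$, which carries the orthogonal sum of the forms $B_i$ to the standard symplectic form of $\mathbb C^{2n}$. -/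

import Mathlib

open scoped Matrix

noncomputable section

/-! ### Galois groups, inertia and Frobenius

A non-archimedean local field is a nontrivially normed field `k` which is ultrametric and locally
compact.  The unique extension of its absolute value to an algebraic closure `kbar` is
`spectralNorm k kbar`; thus the ring of integers of `kbar` is the closed unit ball of the spectral
norm and its maximal ideal is the open unit ball. -/

section Galois

/-- The residue field of `k`. -/
abbrev residueFieldOf (k : Type*) [NontriviallyNormedField k] [IsUltrametricDist k] : Type _ :=
  IsLocalRing.ResidueField (NormedField.valuation (K := k)).valuationSubring

/-- The cardinality `q` of the residue field. -/
def residueCard (k : Type*) [NontriviallyNormedField k] [IsUltrametricDist k] : ℕ :=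
  Nat.card (residueFieldOf k)

/-- The characteristic `p` of the residue field. -/
def residueChar (k : Type*) [NontriviallyNormedField k] [IsUltrametricDist k] : ℕ :=
  ringChar (residueFieldOf k)

variable (k kbar : Type*) [NontriviallyNormedField k] [IsUltrametricDist k]
  [Field kbar] [Algebra k kbar] [IsAlgClosure k kbar]

/-- The inertia group `I`: the automorphisms acting trivially on the residue field of `kbar`. -/
def inertiaGroup : Subgroup Gal(kbar/k) where
  carrier := {σ | ∀ x : kbar, spectralNorm k kbar x ≤ 1 → spectralNorm k kbar (σ x - x) < 1}
  one_mem' := by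
    intro x _
    simp [spectralNorm_zero]
  mul_mem' := by
    intro σ τ hσ hτ x hx
    have h1 := hσ (τ x) (by rwa [← spectralNorm_eq_of_equiv])
    have h2 := hτ x hx
    have h3 := isNonarchimedean_spectralNorm (K := k) (L := kbar) (σ (τ x) - τ x) (τ x - x)
    rw [sub_add_sub_cancel] at h3
    exact lt_of_le_of_lt h3 (max_lt h1 h2)
  inv_mem' := by
    intro σ hσ x hx
    have hx' : spectralNorm k kbar (σ⁻¹ x) ≤ 1 := by rwa [← spectralNorm_eq_of_equiv]
    have h := hσ (σ⁻¹ x) hx'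
    have e : σ (σ⁻¹ x) = x := by
      rw [← AlgEquiv.mul_apply, mul_inv_cancel, AlgEquiv.one_apply]
    rw [e, ← neg_sub, spectralNorm_neg (Algebra.IsAlgebraic.isAlgebraic _)] at h
    exact h

instance inertiaGroup_normal : (inertiaGroup k kbar).Normal where
  conj_mem := by
    intro σ hσ g x hx
    have hx' : spectralNorm k kbar (g⁻¹ x) ≤ 1 := by rwa [← spectralNorm_eq_of_equiv]
    have h := hσ (g⁻¹ x) hx'
    rw [spectralNorm_eq_of_equiv g, map_sub] at h
    have e : g (g⁻¹ x) = x := by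
      rw [← AlgEquiv.mul_apply, mul_inv_cancel, AlgEquiv.one_apply]
    rw [e] at h
    exact h

/-- A topological group is pro-`p` if it is profinite and all its quotients by open normal
subgroups are `p`-groups. -/
def IsProPGroup (p : ℕ) (P : Type*) [Group P] [TopologicalSpace P] : Prop :=
  CompactSpace P ∧ TotallyDisconnectedSpace P ∧
    ∀ (U : Subgroup P) [U.Normal], IsOpen (U : Set P) → IsPGroup p (P ⧸ U)

/-- The wild inertia group `I⁺`: the maximal pro-`p` subgroup of the inertia group (the join of
all its pro-`p` subgroups). -/
def wildInertiaGroup : Subgroup Gal(kbar/k) :=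
  sSup {P | P ≤ inertiaGroup k kbar ∧ IsProPGroup (residueChar k) P}

variable {k kbar}

/-- A geometric Frobenius: it induces the inverse of `x ↦ x ^ q` on the residue field of `kbar`. -/
def IsGeometricFrobenius (F : Gal(kbar/k)) : Prop :=
  ∀ x : kbar, spectralNorm k kbar x ≤ 1 → spectralNorm k kbar ((F x) ^ residueCard k - x) < 1

/-! ### The Weil group -/

/-- The Weil group `W_k`, generated by inertia and a fixed Frobenius `F`, as an abstract subgroup of
the Galois group. -/
def weilSubgroup (F : Gal(kbar/k)) : Subgroup Gal(kbar/k) :=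
  inertiaGroup k kbar ⊔ Subgroup.zpowers F

/-- The Weil group `W_k` as a type of its own, since its topology is not the subspace topology. -/
def WeilGroup (F : Gal(kbar/k)) : Type _ := weilSubgroup F

namespace WeilGroup

variable (F : Gal(kbar/k))

instance : Group (WeilGroup F) := inferInstanceAs (Group (weilSubgroup F))

/-- The inclusion of `W_k` in the Galois group. -/
def toGal : WeilGroup F →* Gal(kbar/k) := (weilSubgroup F).subtype

/-- The inclusion of the inertia group in `W_k`. -/
def ofInertia : inertiaGroup k kbar →* WeilGroup F :=
  Subgroup.inclusion (le_sup_left : inertiaGroup k kbar ≤ weilSubgroup F)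

/-- The fixed Frobenius as an element of `W_k`. -/
def frob : WeilGroup F :=
  ⟨F, (le_sup_right : Subgroup.zpowers F ≤ weilSubgroup F) (Subgroup.mem_zpowers F)⟩

/-- The topology of the Weil group: the inertia group, with its profinite topology, is an open
subgroup; a set is open if and only if its trace on each coset `w I` is open. -/
instance : TopologicalSpace (WeilGroup F) where
  IsOpen U := ∀ w : WeilGroup F, IsOpen {σ : inertiaGroup k kbar | w * ofInertia F σ ∈ U}
  isOpen_univ := fun w => by simp
  isOpen_inter := fun U V hU hV w => (hU w).inter (hV w)
  isOpen_sUnion := fun S hS w => by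
    have : {σ : inertiaGroup k kbar | w * ofInertia F σ ∈ ⋃₀ S} =
        ⋃ U ∈ S, {σ : inertiaGroup k kbar | w * ofInertia F σ ∈ U} := by
      ext σ; simp
    rw [this]
    exact isOpen_biUnion fun U hU => hS U hU w

/-- The inertia subgroup of `W_k`. -/
def inertia : Subgroup (WeilGroup F) := (inertiaGroup k kbar).comap (toGal F)

/-- The wild inertia subgroup of `W_k`. -/
def wildInertia : Subgroup (WeilGroup F) := (wildInertiaGroup k kbar).comap (toGal F)

instance inertia_normal : (inertia F).Normal := Subgroup.Normal.comap inferInstance _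

/-- For the unramified extension `k_m` of degree `m` of `k`, the Weil group
`W_{k_m} = ⟨Frob ^ m⟩ ⋉ I` as a subgroup of `W_k`. -/
def unramified (m : ℕ) : Subgroup (WeilGroup F) :=
  inertia F ⊔ Subgroup.zpowers (frob F ^ m)

theorem inertia_sup_frob : inertia F ⊔ Subgroup.zpowers (frob F) = ⊤ := by
  rw [eq_top_iff]
  rintro ⟨w, hw⟩ -
  have hw' := hw
  unfold weilSubgroup at hw'
  rw [← SetLike.mem_coe, Subgroup.normal_mul] at hw'
  obtain ⟨σ, hσ, g, hg, rfl⟩ := hw'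
  obtain ⟨j, rfl⟩ := Subgroup.mem_zpowers_iff.mp hg
  have h1 : ofInertia F ⟨σ, hσ⟩ ∈ inertia F := hσ
  have h2 : frob F ^ j ∈ Subgroup.zpowers (frob F) := Subgroup.zpow_mem_zpowers _ _
  have h3 := Subgroup.mul_mem_sup h1 h2
  exact h3

instance unramified_normal (m : ℕ) : (unramified F m).Normal := by
  apply Subgroup.Normal.of_commutator_le
  refine le_trans ?_ (le_sup_left : inertia F ≤ unramified F m)
  exact Subgroup.Normal.commutator_le_of_self_sup_commutative_eq_top
    (inertia_sup_frob F) inferInstance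

/-- `Frob ^ m` as an element of `W_{k_m}`. -/
def frobPow (m : ℕ) : unramified F m :=
  ⟨frob F ^ m, (le_sup_right : Subgroup.zpowers (frob F ^ m) ≤ unramified F m)
    (Subgroup.mem_zpowers _)⟩

end WeilGroup

/-- The Weil-Deligne group `W_k × SL₂(ℂ)`. -/
abbrev WeilDeligneGroup (F : Gal(kbar/k)) : Type _ :=
  WeilGroup F × Matrix.SpecialLinearGroup (Fin 2) ℂ

end Galois

/-! ### Characters and induced representations -/

section Induction

variable {G : Type*} [Group G] {H : Subgroup G}

/-- The conjugate `η^g` of a character `η` of a normal subgroup: `η^g(h) = η(g⁻¹ h g)`. -/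
def conjChar [H.Normal] (g : G) (η : H →* ℂˣ) : H →* ℂˣ :=
  η.comp (MulAut.conjNormal g⁻¹ : MulAut H).toMonoidHom

/-- The one-dimensional representation given by a character. -/
def charRep (η : H →* ℂˣ) : Representation ℂ H ℂ where
  toFun h := (η h : ℂ) • LinearMap.id
  map_one' := by ext; simp
  map_mul' _ _ := by ext; simp [mul_comm]

/-- The space of `V(η) = Ind_H^G η`. -/
abbrev IndSpace (η : H →* ℂˣ) : Type _ := Representation.IndV H.subtype (charRep η)

/-- The representation `V(η) = Ind_H^G η`. -/
abbrev indRep (η : H →* ℂˣ) : Representation ℂ G (IndSpace η) :=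
  Representation.ind H.subtype (charRep η)

/-- `B` is a symplectic form on the space of `ρ` on which `ρ` acts by similitudes, with similitude
character `lam`. -/
structure IsSymplecticFormFor {V : Type*} [AddCommGroup V] [Module ℂ V]
    (ρ : Representation ℂ G V) (lam : G →* ℂˣ) (B : LinearMap.BilinForm ℂ V) : Prop where
  alt : B.IsAlt
  nondegenerate : B.Nondegenerate
  similitude : ∀ g v w, B (ρ g v) (ρ g w) = (lam g : ℂ) * B v w

end Induction

/-! ### The general symplectic group -/

section GSp

/-- The standard symplectic form on `ℂ^{2n}`. -/
def stdSymplecticForm (n : ℕ) : LinearMap.BilinForm ℂ (Fin n ⊕ Fin n → ℂ) :=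
  Matrix.toBilin' (Matrix.J (Fin n) ℂ)

/-- `GSp_{2n}(ℂ)`, the group of symplectic similitudes of `ℂ^{2n}`. -/
def GSp (n : ℕ) : Subgroup (GL (Fin n ⊕ Fin n) ℂ) where
  carrier := {g | ∃ c : ℂˣ, ∀ v w, stdSymplecticForm n (g.1 *ᵥ v) (g.1 *ᵥ w) =
    (c : ℂ) * stdSymplecticForm n v w}
  one_mem' := ⟨1, by simp⟩
  mul_mem' := by
    rintro g h ⟨c, hc⟩ ⟨d, hd⟩
    refine ⟨c * d, fun v w => ?_⟩
    have e : ∀ v, (g * h).1 *ᵥ v = g.1 *ᵥ (h.1 *ᵥ v) := fun v => by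
      rw [Matrix.mulVec_mulVec]; rfl
    rw [e, e, hc, hd, Units.val_mul, mul_assoc]
  inv_mem' := by
    rintro g ⟨c, hc⟩
    refine ⟨c⁻¹, fun v w => ?_⟩
    have e : ∀ v, g.1 *ᵥ ((g⁻¹).1 *ᵥ v) = v := fun v => by
      rw [Matrix.mulVec_mulVec, ← Units.val_mul, mul_inv_cancel, Units.val_one, Matrix.one_mulVec]
    have h := hc ((g⁻¹).1 *ᵥ v) ((g⁻¹).1 *ᵥ w)
    rw [e, e] at h
    rw [h, ← mul_assoc, ← Units.val_mul, inv_mul_cancel, Units.val_one, one_mul]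

/-- The matrix of an element of `GSp_{2n}(ℂ)`. -/
def GSp.mat {n : ℕ} (g : GSp n) : Matrix (Fin n ⊕ Fin n) (Fin n ⊕ Fin n) ℂ := g.1.1

/-- `g` has similitude factor `c`. -/
def GSp.HasSimilitude {n : ℕ} (g : GSp n) (c : ℂˣ) : Prop :=
  ∀ v w, stdSymplecticForm n (GSp.mat g *ᵥ v) (GSp.mat g *ᵥ w) = (c : ℂ) * stdSymplecticForm n v w

/-- Zariski closed subgroups of `GSp_{2n}(ℂ)`: those cut out by polynomials in the matrix entries.
-/
def IsZariskiClosed {n : ℕ} (T : Subgroup (GSp n)) : Prop :=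
  ∃ S : Set (MvPolynomial ((Fin n ⊕ Fin n) × (Fin n ⊕ Fin n)) ℂ),
    ∀ g : GSp n, g ∈ T ↔ ∀ f ∈ S, MvPolynomial.eval (fun ij => GSp.mat g ij.1 ij.2) f = 0

/-- Tori in `GSp_{2n}(ℂ)`: connected diagonalizable Zariski closed subgroups. -/
structure IsTorus {n : ℕ} (T : Subgroup (GSp n)) : Prop where
  zariskiClosed : IsZariskiClosed T
  connected : IsConnected (T : Set (GSp n))
  diagonalizable : ∃ P : GL (Fin n ⊕ Fin n) ℂ, ∀ g ∈ T, (P.1 * GSp.mat g * (P⁻¹).1).IsDiag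

/-- Maximal tori in `GSp_{2n}(ℂ)`. -/
def IsMaximalTorus {n : ℕ} (T : Subgroup (GSp n)) : Prop := Maximal IsTorus T

end GSp

/-! ### Langlands parameters -/

section Parameters

variable {k kbar : Type*} [NontriviallyNormedField k] [IsUltrametricDist k]
  [Field kbar] [Algebra k kbar] [IsAlgClosure k kbar]

/-- A Langlands parameter: a continuous homomorphism `W_k × SL₂(ℂ) → GSp_{2n}(ℂ)` which sends
Frobenius to a semisimple element. -/
structure LanglandsParameter (F : Gal(kbar/k)) (n : ℕ) where
  /-- The underlying continuous homomorphism. -/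
  hom : WeilDeligneGroup F →ₜ* GSp n
  semisimple : Module.End.IsSemisimple (Matrix.toLin' (GSp.mat (hom (WeilGroup.frob F, 1))))

namespace LanglandsParameter

variable {F : Gal(kbar/k)} {n : ℕ} (φ : LanglandsParameter F n)

/-- The restriction of a parameter to the Weil group. -/
def onWeil : WeilGroup F →* GSp n := φ.hom.toMonoidHom.comp (MonoidHom.inl _ _)

/-- Tame: trivial on wild inertia. -/
def IsTame : Prop := ∀ w ∈ WeilGroup.wildInertia F, φ.onWeil w = 1

/-- Regular: the centralizer of the image of inertia is a maximal torus. -/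
def IsRegular : Prop :=
  IsMaximalTorus (Subgroup.centralizer (φ.onWeil '' (WeilGroup.inertia F : Set (WeilGroup F))))

/-- Discrete series: the centralizer of the image of `W_k` and the center of `GSp_{2n}(ℂ)` have the
same identity component. -/
def IsDiscreteSeries : Prop :=
  connectedComponentIn (Subgroup.centralizer (Set.range φ.onWeil) : Set (GSp n)) 1 =
    connectedComponentIn (Subgroup.center (GSp n) : Set (GSp n)) 1

/-- The similitude character of `φ` is `lam`. -/
def HasSimilitudeCharacter (lam : WeilGroup F →* ℂˣ) : Prop :=
  ∀ w, GSp.HasSimilitude (φ.onWeil w) (lam w)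

end LanglandsParameter

/-- The conditions on a character `η` of `W_{k_{2d}}` expressing that `V(η)` is tame, irreducible,
and symplectic with similitude character `lam`. -/
structure IsAdmissibleCharacter {F : Gal(kbar/k)} (lam : WeilGroup F →* ℂˣ) (d : ℕ)
    (η : WeilGroup.unramified F (2 * d) →ₜ* ℂˣ) : Prop where
  tame : ∀ w : WeilGroup.unramified F (2 * d), (w : WeilGroup F) ∈ WeilGroup.wildInertia F → η w = 1
  /-- `η, η^Frob, …, η^(Frob^(2d-1))` are pairwise distinct. -/
  distinct : ∀ a < 2 * d, ∀ b < 2 * d, a ≠ b →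
    conjChar (WeilGroup.frob F ^ a) η.toMonoidHom ≠ conjChar (WeilGroup.frob F ^ b) η.toMonoidHom
  /-- `η · η^(Frob^d)` is the restriction of `lam`. -/
  mul_conj : ∀ w : WeilGroup.unramified F (2 * d),
    η w * conjChar (WeilGroup.frob F ^ d) η.toMonoidHom w = lam w
  /-- `η(Frob^(2d)) = - lam(Frob^d)`. -/
  frob : η (WeilGroup.frobPow F (2 * d)) = -lam (WeilGroup.frob F ^ d)

end Parameters

end

/-!
The centralizer `T` of `φ(I)` is a maximal torus. A torus consists of commuting diagonalizable
similitudes, so it has a symplectic basis of common eigenvectors (`exists_symplectic_eigenfamily`);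
by maximality `T` is the group of all similitudes which are diagonal in this basis
(`IsMaximalTorus.exists_eq_diagonalSubgroup`). Three consequences use no ramification theory.

* `φ(SL₂(ℂ))` lies in the abelian group `T`, and `SL₂(ℂ)` is perfect, so `φ` is trivial on it.
* `φ(I)` centralizes `T`, and `T` is its own centralizer, so `φ(I)` is diagonal in the same basis
  (`subset_diagonalSubgroup`).
* The `2n` characters of `I` on the basis vectors are pairwise distinct, since otherwise a
  symplectic transvection outside `T` would centralize `φ(I)` (`exists_diag_ne`).

Frobenius therefore permutes the `2n` lines by a permutation `σ`, which commutes with the duality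
`τ` of the lines under the symplectic form. Suppose that some `σ`-orbit differs from its dual orbit.
Then scaling the first by `z` and the second by `z⁻¹` defines a connected group of noncentral
elements of the centralizer of `φ(W_k)`, contrary to the discrete series hypothesis
(`LanglandsParameter.IsDiscreteSeries.sameCycle_swap`). So every orbit is self-dual; it has even
length `2d`, and `τ = σ ^ d` on it (`exists_orbit_representatives`).

Let `v` span a line of such an orbit. Its stabilizer contains `W_{k_{2d}}`, which acts on `v` by
a character `η`. By Frobenius reciprocity `V(η)` maps to `ℂ^{2n}`, and its coset basis goes to
`v, Frob v, …, Frob^{2d-1} v`, that is, to a basis of the sum of the lines of the orbit. The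
similitude property for the dual vectors `v` and `Frob^d v` gives `η · η^{Frob^d} = λ`, and the
alternation of the form gives `η(Frob^{2d}) = -λ(Frob^d)`. Irreducibility and inequivalence hold
because `I` acts on the lines by distinct characters. All this is
`exists_symplectic_decomposition`, a statement about an arbitrary group.
-/

noncomputable section

/-! ### Symplectic bases of common eigenvectors -/

section SymplecticEigenbasis

variable {V : Type*} [AddCommGroup V] [Module ℂ V]

/-- `v` is an eigenvector (or zero) of every operator in `S`. -/
def IsCommonEigenvector (S : Set (V →ₗ[ℂ] V)) (v : V) : Prop :=
  ∀ g ∈ S, ∃ μ : ℂ, g v = μ • v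

/-- `e` minus its orthogonal projection to the span of the symplectic family `c`; the signs are
those of `Matrix.J`, for which `ω (c (inl i)) (c (inr i)) = -1`. -/
def symplecticResidue (ω : LinearMap.BilinForm ℂ V) {r : ℕ} (c : Fin r ⊕ Fin r → V) (e : V) : V :=
  e - ∑ i, ω e (c (.inl i)) • c (.inr i) + ∑ i, ω e (c (.inr i)) • c (.inl i)

lemma symplecticResidue_orthogonal {ω : LinearMap.BilinForm ℂ V} {r : ℕ}
    {c : Fin r ⊕ Fin r → V} (hc : ∀ x y, ω (c x) (c y) = Matrix.J (Fin r) ℂ x y)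
    (e : V) (y : Fin r ⊕ Fin r) : ω (symplecticResidue ω c e) (c y) = 0 := by
  rcases y with j | j <;>
    simp [symplecticResidue, hc, Matrix.J, Matrix.one_apply, LinearMap.sum_apply]

/-- The projection commutes with similitudes of which all members of `c` are eigenvectors. -/
lemma symplecticResidue_isCommonEigenvector {ω : LinearMap.BilinForm ℂ V}
    {S : Set (V →ₗ[ℂ] V)}
    (hS : ∀ g ∈ S, ∃ a : ℂ, a ≠ 0 ∧ ∀ v w, ω (g v) (g w) = a * ω v w) {r : ℕ}
    {c : Fin r ⊕ Fin r → V} (hc : ∀ x y, ω (c x) (c y) = Matrix.J (Fin r) ℂ x y)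
    (hcS : ∀ x, IsCommonEigenvector S (c x)) {e : V} (he : IsCommonEigenvector S e) :
    IsCommonEigenvector S (symplecticResidue ω c e) := by
  intro g hg
  obtain ⟨a, ha, hsim⟩ := hS g hg
  obtain ⟨μ, hμ⟩ := he g hg
  choose m hm using fun x => hcS x g hg
  have hpair : ∀ i, m (.inl i) * m (.inr i) = a := by
    intro i
    have := hsim (c (.inr i)) (c (.inl i))
    rw [hm, hm] at this
    simpa [hc, Matrix.J, Matrix.one_apply, mul_comm] using this
  -- if `e` pairs with `c x`, it has the eigenvalue of the partner of `c x` in the family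
  have key : ∀ x, ω e (c x) ≠ 0 → μ * m x = a := by
    intro x hx
    have := hsim e (c x)
    rw [hμ, hm] at this
    simp only [map_smul, LinearMap.smul_apply, smul_eq_mul] at this
    apply mul_right_cancel₀ hx
    rw [← this]; ring
  have hl : ∀ i, g (ω e (c (.inl i)) • c (.inr i)) = μ • (ω e (c (.inl i)) • c (.inr i)) := by
    intro i
    by_cases h0 : ω e (c (.inl i)) = 0
    · simp [h0]
    have h1 := key _ h0
    have h2 := hpair i
    have h3 : m (.inl i) ≠ 0 := by rintro h; rw [h, zero_mul] at h2; exact ha h2.symm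
    have : m (.inr i) = μ := by
      apply mul_left_cancel₀ h3; rw [h2, ← h1, mul_comm]
    rw [map_smul, hm, this, smul_comm]
  have hr : ∀ i, g (ω e (c (.inr i)) • c (.inl i)) = μ • (ω e (c (.inr i)) • c (.inl i)) := by
    intro i
    by_cases h0 : ω e (c (.inr i)) = 0
    · simp [h0]
    have h1 := key _ h0
    have h2 := hpair i
    have h3 : m (.inr i) ≠ 0 := by rintro h; rw [h, mul_zero] at h2; exact ha h2.symm
    have : m (.inl i) = μ := by
      apply mul_right_cancel₀ h3; rw [h2, ← h1]
    rw [map_smul, hm, this, smul_comm]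
  refine ⟨μ, ?_⟩
  simp only [symplecticResidue, map_add, map_sub, map_sum, hl, hr, hμ, smul_add, smul_sub,
    Finset.smul_sum]

/-- A set of symplectic similitudes whose common eigenvectors span has symplectic families of
common eigenvectors of every possible size. -/
theorem exists_symplectic_eigenfamily [FiniteDimensional ℂ V] {ω : LinearMap.BilinForm ℂ V}
    (halt : ω.IsAlt) (hnd : ∀ v, (∀ w, ω v w = 0) → v = 0) {S : Set (V →ₗ[ℂ] V)}
    (hS : ∀ g ∈ S, ∃ a : ℂ, a ≠ 0 ∧ ∀ v w, ω (g v) (g w) = a * ω v w)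
    (hspan : Submodule.span ℂ {v | IsCommonEigenvector S v} = ⊤) (r : ℕ)
    (hr : 2 * r ≤ Module.finrank ℂ V) :
    ∃ c : Fin r ⊕ Fin r → V, (∀ x, IsCommonEigenvector S (c x)) ∧
      ∀ x y, ω (c x) (c y) = Matrix.J (Fin r) ℂ x y := by
  induction r with
  | zero => exact ⟨isEmptyElim, isEmptyElim, isEmptyElim⟩
  | succ r ih =>
    obtain ⟨c, hcS, hc⟩ := ih (by omega)
    -- a family of `2 r` vectors does not span, so some eigenvector has a nonzero residue
    obtain ⟨e, he, hne⟩ : ∃ e, IsCommonEigenvector S e ∧ symplecticResidue ω c e ≠ 0 := by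
      by_contra! hcon
      have hle : (⊤ : Submodule ℂ V) ≤ Submodule.span ℂ (Set.range c) := by
        rw [← hspan, Submodule.span_le]
        intro e he
        have h0 := hcon e he
        have : e = ∑ i, ω e (c (.inl i)) • c (.inr i) - ∑ i, ω e (c (.inr i)) • c (.inl i) := by
          rw [← sub_eq_zero, ← h0, symplecticResidue]; abel
        rw [SetLike.mem_coe, this]
        exact Submodule.sub_mem _
          (Submodule.sum_mem _ fun i _ => Submodule.smul_mem _ _ (Submodule.subset_span ⟨_, rfl⟩))
          (Submodule.sum_mem _ fun i _ => Submodule.smul_mem _ _ (Submodule.subset_span ⟨_, rfl⟩))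
      have h1 := finrank_range_le_card (R := ℂ) c
      rw [Set.finrank, top_le_iff.mp hle, finrank_top] at h1
      simp at h1
      omega
    obtain ⟨e', he', hne'⟩ : ∃ e', IsCommonEigenvector S e' ∧
        ω (symplecticResidue ω c e) e' ≠ 0 := by
      by_contra! hcon
      apply hne
      apply hnd
      intro w
      have hw : w ∈ Submodule.span ℂ {v | IsCommonEigenvector S v} := hspan ▸ Submodule.mem_top
      have hle : Submodule.span ℂ {v | IsCommonEigenvector S v} ≤
          LinearMap.ker (ω (symplecticResidue ω c e)) :=
        Submodule.span_le.mpr fun v hv => hcon v hv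
      exact hle hw
    set u := symplecticResidue ω c e with hu
    set t := symplecticResidue ω c e' with ht
    have huc : ∀ y, ω u (c y) = 0 := symplecticResidue_orthogonal hc e
    have htc : ∀ y, ω t (c y) = 0 := symplecticResidue_orthogonal hc e'
    have hcu : ∀ y, ω (c y) u = 0 := fun y => by rw [← halt.neg_eq, huc, neg_zero]
    have hct : ∀ y, ω (c y) t = 0 := fun y => by rw [← halt.neg_eq, htc, neg_zero]
    have hut : ω u t ≠ 0 := by
      rw [ht, symplecticResidue]
      simpa [huc] using hne'
    have huS := symplecticResidue_isCommonEigenvector hS hc hcS he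
    have htS := symplecticResidue_isCommonEigenvector hS hc hcS he'
    have htS' : IsCommonEigenvector S ((ω u t)⁻¹ • t) := by
      intro g hg
      obtain ⟨μ, hμ⟩ := htS g hg
      exact ⟨μ, by rw [map_smul, hμ, smul_comm]⟩
    have htu : ω t u = -ω u t := (halt.neg_eq u t).symm
    refine ⟨Sum.elim (Fin.cons ((ω u t)⁻¹ • t) fun i => c (.inl i))
      (Fin.cons u fun i => c (.inr i)), ?_, ?_⟩
    · rintro (i | i) <;> refine Fin.cases ?_ (fun j => ?_) i
      · simpa using htS'
      · simpa using hcS _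
      · simpa using huS
      · simpa using hcS _
    · rintro (i | i) (j | j) <;> refine Fin.cases ?_ (fun i' => ?_) i <;>
        refine Fin.cases ?_ (fun j' => ?_) j <;>
        simp [Matrix.J, Matrix.one_apply, huc, htc, hcu, hct, hc, halt.self_eq_zero, hut, htu,
          Fin.succ_ne_zero, (Fin.succ_ne_zero _).symm]

end SymplecticEigenbasis

/-! ### Similitudes and their matrices -/

section Similitudes

variable {n : ℕ}

lemma stdSymplecticForm_single (x y : Fin n ⊕ Fin n) :
    stdSymplecticForm n (Pi.single x 1) (Pi.single y 1) = Matrix.J (Fin n) ℂ x y :=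
  Matrix.toBilin'_single _ _ _

lemma stdSymplecticForm_apply (v w : Fin n ⊕ Fin n → ℂ) :
    stdSymplecticForm n v w = ∑ i, (v (.inr i) * w (.inl i) - v (.inl i) * w (.inr i)) := by
  simp [stdSymplecticForm, Matrix.toBilin'_apply, Matrix.J, Matrix.one_apply,
    Fintype.sum_sum_type, Finset.sum_add_distrib, sub_eq_add_neg, add_comm]

lemma stdSymplecticForm_isAlt : (stdSymplecticForm n).IsAlt := fun v => by
  simp [stdSymplecticForm_apply, mul_comm]

lemma stdSymplecticForm_separating (v : Fin n ⊕ Fin n → ℂ)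
    (h : ∀ w, stdSymplecticForm n v w = 0) : v = 0 := by
  ext x
  have := h (Pi.single x.swap 1)
  rcases x with i | i <;> simpa [stdSymplecticForm_apply, Pi.single_apply] using this

lemma J_ne_zero_iff (x y : Fin n ⊕ Fin n) : Matrix.J (Fin n) ℂ x y ≠ 0 ↔ y = x.swap := by
  rcases x with i | i <;> rcases y with j | j <;>
    simp [Matrix.J, Matrix.one_apply, eq_comm]

/-- The similitude of `ℂ^{2n}` given by a linear endomorphism; its invertibility is automatic. -/
def GSp.ofLinear (f : Module.End ℂ (Fin n ⊕ Fin n → ℂ)) (c : ℂˣ)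
    (hf : ∀ v w, stdSymplecticForm n (f v) (f w) = (c : ℂ) * stdSymplecticForm n v w) : GSp n :=
  have hinj : Function.Injective f := by
    rw [← LinearMap.ker_eq_bot, LinearMap.ker_eq_bot']
    intro v hv
    apply stdSymplecticForm_separating
    intro w
    have h := hf v w
    rw [hv, map_zero, LinearMap.zero_apply] at h
    exact (mul_eq_zero.mp h.symm).resolve_left c.ne_zero
  ⟨Matrix.GeneralLinearGroup.toLin.symm
    (LinearMap.GeneralLinearGroup.ofLinearEquiv (LinearEquiv.ofInjectiveEndo f hinj)), c, by
      intro v w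
      rw [← hf]
      congr 1
      · congr 1
        exact congrFun (congrArg DFunLike.coe (Matrix.toLin'_toMatrix' f)) v
      · exact congrFun (congrArg DFunLike.coe (Matrix.toLin'_toMatrix' f)) w⟩

lemma GSp.mat_ofLinear_mulVec (f : Module.End ℂ (Fin n ⊕ Fin n → ℂ)) (c : ℂˣ)
    (hf : ∀ v w, stdSymplecticForm n (f v) (f w) = (c : ℂ) * stdSymplecticForm n v w)
    (v : Fin n ⊕ Fin n → ℂ) : GSp.mat (GSp.ofLinear f c hf) *ᵥ v = f v :=
  congrFun (congrArg DFunLike.coe (Matrix.toLin'_toMatrix' f)) v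

@[simp] lemma GSp.mat_one : GSp.mat (1 : GSp n) = 1 := rfl

@[simp] lemma GSp.mat_mul (g h : GSp n) : GSp.mat (g * h) = GSp.mat g * GSp.mat h := rfl

lemma GSp.mat_mul_inv (g : GSp n) : GSp.mat g * GSp.mat g⁻¹ = 1 := by
  rw [← GSp.mat_mul, mul_inv_cancel, GSp.mat_one]

lemma GSp.mat_inv_mul (g : GSp n) : GSp.mat g⁻¹ * GSp.mat g = 1 := by
  rw [← GSp.mat_mul, inv_mul_cancel, GSp.mat_one]

lemma GSp.mat_injective : Function.Injective (GSp.mat (n := n)) := fun _ _ h =>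
  Subtype.ext (Units.ext h)

lemma GSp.continuous_mat : Continuous (GSp.mat (n := n)) :=
  Units.continuous_val.comp continuous_subtype_val

end Similitudes

/-! ### Maximal tori of the similitude group -/

section MaximalTori

variable {n : ℕ}

/-- The exponent of the entry at `x` of the diagonal similitude with parameters `(c, u)`. -/
def diagExponent (p : ℂ × (Fin n ⊕ Fin n → ℂ)) (x : Fin n ⊕ Fin n) : ℂ :=
  p.1 + p.2 x - p.2 x.swap

/-- The exponential parametrization of the diagonal torus of `GSp_{2n}(ℂ)`. The form of the
exponents makes every parameter admissible: those at `x` and `x.swap` add up to `2 c`. -/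
def diagGSp (p : ℂ × (Fin n ⊕ Fin n → ℂ)) : GSp n :=
  ⟨⟨Matrix.diagonal fun x => Complex.exp (diagExponent p x),
    Matrix.diagonal fun x => Complex.exp (-diagExponent p x),
    by simp [← Complex.exp_add], by simp [← Complex.exp_add]⟩,
    Units.mk0 (Complex.exp (2 * p.1)) (Complex.exp_ne_zero _), by
      have hexp : ∀ i : Fin n, Complex.exp (diagExponent p (.inr i)) *
          Complex.exp (diagExponent p (.inl i)) = Complex.exp (2 * p.1) := by
        intro i
        rw [← Complex.exp_add]
        congr 1
        simp [diagExponent]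
        ring
      intro v w
      simp only [stdSymplecticForm_apply, Matrix.mulVec_diagonal, Units.val_mk0, Finset.mul_sum]
      refine Finset.sum_congr rfl fun i _ => ?_
      rw [← hexp i]
      ring⟩

lemma mat_diagGSp (p : ℂ × (Fin n ⊕ Fin n → ℂ)) :
    GSp.mat (diagGSp p) = Matrix.diagonal fun x => Complex.exp (diagExponent p x) := rfl

lemma continuous_diagGSp : Continuous (diagGSp (n := n)) := by
  refine Continuous.subtype_mk (Units.continuous_iff.mpr ⟨?_, ?_⟩) _
  · refine Continuous.matrix_diagonal ?_
    unfold diagExponent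
    fun_prop
  · refine Continuous.matrix_diagonal ?_
    unfold diagExponent
    fun_prop

/-- The subgroup of `GSp_{2n}(ℂ)` of the elements which are diagonal in the basis formed by the
columns of `Q`. -/
def diagonalSubgroup (Q : GSp n) : Subgroup (GSp n) where
  carrier := {g | (GSp.mat (Q⁻¹ * g * Q)).IsDiag}
  one_mem' := by
    simp only [Set.mem_ofPred_eq, mul_one, inv_mul_cancel, GSp.mat_one]
    exact Matrix.isDiag_one
  mul_mem' := by
    intro g h hg hh
    have e : Q⁻¹ * (g * h) * Q = (Q⁻¹ * g * Q) * (Q⁻¹ * h * Q) := by group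
    simp only [Set.mem_ofPred_eq] at hg hh ⊢
    rw [e, GSp.mat_mul, ← hg.diagonal_diag, ← hh.diagonal_diag, Matrix.diagonal_mul_diagonal]
    exact Matrix.isDiag_diagonal _
  inv_mem' := by
    intro g hg
    simp only [Set.mem_ofPred_eq] at hg ⊢
    have e : Q⁻¹ * g⁻¹ * Q = (Q⁻¹ * g * Q)⁻¹ := by group
    rw [e]
    generalize Q⁻¹ * g * Q = h at hg
    intro x y hxy
    have h1 : (GSp.mat h * GSp.mat h⁻¹) x y = 0 := by
      rw [GSp.mat_mul_inv, Matrix.one_apply_ne hxy]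
    have h2 : (GSp.mat h * GSp.mat h⁻¹) x x = 1 := by
      rw [GSp.mat_mul_inv, Matrix.one_apply_eq]
    rw [← hg.diagonal_diag, Matrix.diagonal_mul] at h1 h2
    refine (mul_eq_zero.mp h1).resolve_left fun h0 => ?_
    rw [h0, zero_mul] at h2
    exact zero_ne_one h2

lemma mem_diagonalSubgroup {Q g : GSp n} :
    g ∈ diagonalSubgroup Q ↔ (GSp.mat (Q⁻¹ * g * Q)).IsDiag := Iff.rfl

/-- A diagonal similitude is the exponential of a diagonal matrix. -/
lemma exists_diagGSp_eq {g : GSp n} (hg : (GSp.mat g).IsDiag) : ∃ p, diagGSp p = g := by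
  obtain ⟨c, hc⟩ := g.2
  have hdiag := hg.diagonal_diag
  set t := (GSp.mat g).diag with ht
  have hmul : ∀ i, t (.inr i) * t (.inl i) = c := by
    intro i
    have := hc (Pi.single (.inr i) 1) (Pi.single (.inl i) 1)
    change stdSymplecticForm n (GSp.mat g *ᵥ _) (GSp.mat g *ᵥ _) = _ at this
    rw [← hdiag] at this
    simpa [stdSymplecticForm_apply, Matrix.mulVec_diagonal, Pi.single_apply] using this
  have hr : ∀ i, t (.inr i) ≠ 0 := fun i h => c.ne_zero (by rw [← hmul i, h, zero_mul])
  have hl : ∀ i, t (.inl i) ≠ 0 := fun i h => c.ne_zero (by rw [← hmul i, h, mul_zero])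
  -- logarithms chosen so that those at `inl i` and `inr i` add up to the same logarithm of `c`
  let z : Fin n ⊕ Fin n → ℂ := Sum.elim (fun i => Complex.log (t (.inl i)))
    (fun i => Complex.log c - Complex.log (t (.inl i)))
  refine ⟨(Complex.log c / 2, fun x => z x / 2), GSp.mat_injective ?_⟩
  rw [mat_diagGSp, ← hdiag]
  congr 1
  ext x
  rcases x with i | i
  · have : diagExponent (Complex.log c / 2, fun x => z x / 2) (Sum.inl i) =
        Complex.log (t (.inl i)) := by simp [diagExponent, z]; ring
    rw [this, Complex.exp_log (hl i)]
  · have : diagExponent (Complex.log c / 2, fun x => z x / 2) (Sum.inr i) =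
        Complex.log c - Complex.log (t (.inl i)) := by simp [diagExponent, z]; ring
    rw [this, Complex.exp_sub, Complex.exp_log (hl i), Complex.exp_log c.ne_zero, ← hmul i,
      mul_div_cancel_right₀ _ (hl i)]

lemma isTorus_diagonalSubgroup (Q : GSp n) : IsTorus (diagonalSubgroup Q) where
  zariskiClosed := by
    refine ⟨{f | ∃ x y, x ≠ y ∧ f = ∑ l, ∑ k, MvPolynomial.C (GSp.mat Q⁻¹ x k) *
      MvPolynomial.X (k, l) * MvPolynomial.C (GSp.mat Q l y)}, fun g => ?_⟩
    have key : ∀ x y, MvPolynomial.eval (fun ij : (Fin n ⊕ Fin n) × (Fin n ⊕ Fin n) =>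
        GSp.mat g ij.1 ij.2) (∑ l, ∑ k, MvPolynomial.C (GSp.mat Q⁻¹ x k) *
      MvPolynomial.X (k, l) * MvPolynomial.C (GSp.mat Q l y)) = GSp.mat (Q⁻¹ * g * Q) x y := by
      intro x y
      simp only [map_sum, map_mul, MvPolynomial.eval_C, MvPolynomial.eval_X, GSp.mat_mul,
        Matrix.mul_apply, Finset.sum_mul]
    rw [mem_diagonalSubgroup]
    constructor
    · rintro h _ ⟨x, y, hxy, rfl⟩
      rw [key]
      exact h hxy
    · intro h x y hxy
      rw [← key]
      exact h _ ⟨x, y, hxy, rfl⟩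
  connected := by
    have : (diagonalSubgroup Q : Set (GSp n)) = Set.range fun p => Q * diagGSp p * Q⁻¹ := by
      ext g
      constructor
      · intro hg
        obtain ⟨p, hp⟩ := exists_diagGSp_eq hg
        exact ⟨p, by simp only [hp]; group⟩
      · rintro ⟨p, rfl⟩
        have e : Q⁻¹ * (Q * diagGSp p * Q⁻¹) * Q = diagGSp p := by group
        rw [SetLike.mem_coe, mem_diagonalSubgroup, e]
        exact Matrix.isDiag_diagonal _
    rw [this]
    exact isConnected_range ((continuous_const.mul continuous_diagGSp).mul continuous_const)
  diagonalizable := ⟨Q⁻¹.1, fun g hg => hg⟩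

/-- Every maximal torus of `GSp_{2n}(ℂ)` is conjugate to the diagonal one. -/
theorem IsMaximalTorus.exists_eq_diagonalSubgroup {T : Subgroup (GSp n)} (hT : IsMaximalTorus T) :
    ∃ Q : GSp n, T = diagonalSubgroup Q := by
  obtain ⟨P, hP⟩ := hT.prop.diagonalizable
  have hPP : P.1 * (P⁻¹).1 = 1 := by rw [← Units.val_mul, mul_inv_cancel, Units.val_one]
  have hPP' : (P⁻¹).1 * P.1 = 1 := by rw [← Units.val_mul, inv_mul_cancel, Units.val_one]
  let S : Set (Module.End ℂ (Fin n ⊕ Fin n → ℂ)) := {f | ∃ g ∈ T, f = Matrix.toLin' (GSp.mat g)}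
  have hspan : Submodule.span ℂ {v | IsCommonEigenvector S v} = ⊤ := by
    rw [eq_top_iff]
    intro v _
    have hv : v = ∑ x, (P.1 *ᵥ v) x • ((P⁻¹).1 *ᵥ Pi.single x 1) := by
      have : P.1 *ᵥ v = ∑ x, (P.1 *ᵥ v) x • (Pi.single x 1 : Fin n ⊕ Fin n → ℂ) := by
        ext y; simp [Finset.sum_apply, Pi.single_apply]
      calc v = (P⁻¹).1 *ᵥ (P.1 *ᵥ v) := by rw [Matrix.mulVec_mulVec, hPP', Matrix.one_mulVec]
        _ = _ := by
          conv_lhs => rw [this]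
          rw [Matrix.mulVec_sum]
          simp only [Matrix.mulVec_smul]
    rw [hv]
    refine Submodule.sum_mem _ fun x _ => Submodule.smul_mem _ _ (Submodule.subset_span ?_)
    rintro _ ⟨g, hg, rfl⟩
    refine ⟨(P.1 * GSp.mat g * (P⁻¹).1) x x, ?_⟩
    have hd := (hP g hg).diagonal_diag
    have e : GSp.mat g * (P⁻¹).1 = (P⁻¹).1 * (P.1 * GSp.mat g * (P⁻¹).1) := by
      rw [← mul_assoc, ← mul_assoc, hPP', one_mul]
    rw [Matrix.toLin'_apply, Matrix.mulVec_mulVec, e, ← hd, ← Matrix.mulVec_mulVec,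
      Matrix.diagonal_mulVec_single, mul_one, Matrix.diagonal_apply_eq]
    rw [← Matrix.mulVec_smul]
    congr 1
    ext y
    simp [Pi.single_apply]
  obtain ⟨c, hcS, hc⟩ := exists_symplectic_eigenfamily (stdSymplecticForm_isAlt (n := n))
    stdSymplecticForm_separating (S := S) (by
      rintro _ ⟨g, hg, rfl⟩
      obtain ⟨a, ha⟩ := g.2
      exact ⟨a, a.ne_zero, ha⟩) hspan n (by simp [two_mul])
  let f := (Pi.basisFun ℂ (Fin n ⊕ Fin n)).constr ℂ c
  have hf : ∀ x, f (Pi.single x 1) = c x := fun x => by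
    rw [← Pi.basisFun_apply, Module.Basis.constr_basis]
  have hform : (stdSymplecticForm n).compl₁₂ f f = stdSymplecticForm n := by
    refine (Pi.basisFun ℂ (Fin n ⊕ Fin n)).ext fun x => (Pi.basisFun ℂ (Fin n ⊕ Fin n)).ext
      fun y => ?_
    simp only [Pi.basisFun_apply, LinearMap.compl₁₂_apply, hf, hc, stdSymplecticForm_single]
  let Q := GSp.ofLinear f 1 fun v w => by
    rw [Units.val_one, one_mul]
    exact LinearMap.congr_fun₂ hform v w
  have hQ : ∀ x, GSp.mat Q *ᵥ Pi.single x 1 = c x := fun x => by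
    rw [GSp.mat_ofLinear_mulVec, hf]
  have hle : T ≤ diagonalSubgroup Q := by
    intro g hg x y hxy
    obtain ⟨μ, hμ⟩ := hcS y _ ⟨g, hg, rfl⟩
    rw [Matrix.toLin'_apply, ← hQ, ← Matrix.mulVec_smul] at hμ
    have h1 : GSp.mat (Q⁻¹ * g * Q) *ᵥ Pi.single y 1 = μ • Pi.single y 1 := by
      rw [mul_assoc, GSp.mat_mul, GSp.mat_mul, ← Matrix.mulVec_mulVec, ← Matrix.mulVec_mulVec, hμ,
        Matrix.mulVec_mulVec, GSp.mat_inv_mul, Matrix.one_mulVec]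
    have h2 := congrFun h1 x
    rw [Matrix.mulVec_single_one] at h2
    simpa [hxy] using h2
  exact ⟨Q, le_antisymm hle (hT.le_of_ge (isTorus_diagonalSubgroup Q) hle)⟩

end MaximalTori

/-! ### Representations induced from characters -/

section InducedCharacters

open scoped TensorProduct

variable {G : Type*} [Group G] {H : Subgroup G} {V : Type*} [AddCommGroup V] [Module ℂ V]

lemma charRep_apply (η : H →* ℂˣ) (h : H) (a : ℂ) : charRep η h a = (η h : ℂ) * a := rfl

/-- The vector `[g ⊗ 1]` of `Ind_H^G η`. -/
def indVec (η : H →* ℂˣ) (g : G) : IndSpace η :=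
  Representation.IndV.mk H.subtype (charRep η) g 1

lemma indRep_indVec (η : H →* ℂˣ) (g h : G) : indRep η g (indVec η h) = indVec η (h * g⁻¹) :=
  Representation.ind_mk _ _ _ _ _

lemma indVec_mul (η : H →* ℂˣ) (h : H) (g : G) :
    indVec η (h * g) = ((η h : ℂ)⁻¹) • indVec η g := by
  have h1 := Representation.Coinvariants.mk_self_apply
    (Representation.tprod ((Representation.leftRegular ℂ G).comp H.subtype) (charRep η)) h
    (MonoidAlgebra.single g 1 ⊗ₜ[ℂ] (1 : ℂ))
  have h2 : (η h : ℂ) • indVec η (h * g) = indVec η g := by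
    refine Eq.trans ?_ h1
    rw [indVec, ← map_smul]
    simp [Representation.IndV.mk, charRep_apply]
  rw [← h2, inv_smul_smul₀ (η h).ne_zero]

lemma span_indVec (η : H →* ℂˣ) : Submodule.span ℂ (Set.range (indVec η)) = ⊤ := by
  have : (Submodule.span ℂ (Set.range (indVec η))).mkQ = 0 := by
    apply Representation.IndV.hom_ext
    intro g
    ext
    simp only [LinearMap.comp_apply, LinearMap.zero_apply]
    exact (Submodule.Quotient.mk_eq_zero _).mpr (Submodule.subset_span ⟨g, rfl⟩)
  rw [← Submodule.ker_mkQ (Submodule.span ℂ (Set.range (indVec η))), this, LinearMap.ker_zero]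

lemma indSpace_hom_ext {η : H →* ℂˣ} {f g : IndSpace η →ₗ[ℂ] V}
    (h : ∀ x, f (indVec η x) = g (indVec η x)) : f = g :=
  LinearMap.ext_on_range (span_indVec η) h

/-- Frobenius reciprocity: a vector on which `H` acts by `η` determines a linear map from
`Ind_H^G η`. -/
def indLift (η : H →* ℂˣ) (ρ : Representation ℂ G V) (v : V)
    (hv : ∀ h : H, ρ h v = (η h : ℂ) • v) : IndSpace η →ₗ[ℂ] V :=
  Representation.Coinvariants.lift _
    (TensorProduct.lift
      (Finsupp.linearCombination ℂ (fun g : G => LinearMap.toSpanSingleton ℂ V (ρ g⁻¹ v)) ∘ₗ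
        (MonoidAlgebra.coeffLinearEquiv ℂ).toLinearMap))
    (by
      intro h
      have hinv : (η h : ℂ) • ρ (h : G)⁻¹ v = v := by
        rw [← map_smul, ← hv, Representation.inv_self_apply]
      refine TensorProduct.ext (MonoidAlgebra.lhom_ext' fun g => LinearMap.ext_ring ?_)
      ext
      simp [charRep_apply, ← map_smul, hinv])

lemma indLift_indVec (η : H →* ℂˣ) (ρ : Representation ℂ G V) (v : V)
    (hv : ∀ h : H, ρ h v = (η h : ℂ) • v) (g : G) :
    indLift η ρ v hv (indVec η g) = ρ g⁻¹ v := by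
  simp [indLift, indVec, Representation.IndV.mk]

lemma indLift_indRep (η : H →* ℂˣ) (ρ : Representation ℂ G V) (v : V)
    (hv : ∀ h : H, ρ h v = (η h : ℂ) • v) (g : G) (x : IndSpace η) :
    indLift η ρ v hv (indRep η g x) = ρ g (indLift η ρ v hv x) := by
  have : indLift η ρ v hv ∘ₗ indRep η g = ρ g ∘ₗ indLift η ρ v hv := by
    apply indSpace_hom_ext
    intro y
    simp only [LinearMap.comp_apply, indRep_indVec, indLift_indVec, mul_inv_rev, inv_inv, map_mul,
      Module.End.mul_apply]
  exact LinearMap.congr_fun this x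

/-- Coset representatives `t` give a basis of `Ind_H^G η`, if the vectors to which they are mapped
in some representation are linearly independent. -/
def indBasis (η : H →* ℂˣ) (ρ : Representation ℂ G V) (v : V)
    (hv : ∀ h : H, ρ h v = (η h : ℂ) • v) {κ : Type*} (t : κ → G)
    (ht : ∀ g, ∃ (h : H) (j : κ), g = h * t j)
    (hli : LinearIndependent ℂ fun j => ρ (t j)⁻¹ v) : Module.Basis κ ℂ (IndSpace η) :=
  Module.Basis.mk (v := fun j => indVec η (t j))
    (LinearIndependent.of_comp (indLift η ρ v hv) (by
      simpa only [Function.comp_def, indLift_indVec] using hli))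
    (by
      rw [← span_indVec, Submodule.span_le]
      rintro _ ⟨g, rfl⟩
      obtain ⟨h, j, rfl⟩ := ht g
      rw [indVec_mul]
      exact Submodule.smul_mem _ _ (Submodule.subset_span ⟨j, rfl⟩))

lemma indBasis_apply (η : H →* ℂˣ) (ρ : Representation ℂ G V) (v : V)
    (hv : ∀ h : H, ρ h v = (η h : ℂ) • v) {κ : Type*} (t : κ → G)
    (ht : ∀ g, ∃ (h : H) (j : κ), g = h * t j)
    (hli : LinearIndependent ℂ fun j => ρ (t j)⁻¹ v) (j : κ) :
    indBasis η ρ v hv t ht hli j = indVec η (t j) :=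
  Module.Basis.mk_apply _ _ j

end InducedCharacters

/-! ### Monomial representations with distinct characters -/

section MonomialRepresentations

variable {G : Type*} [Group G] {V : Type*} [AddCommGroup V] [Module ℂ V]
  {ρ : Representation ℂ G V} {I : Subgroup G} {ι : Type*} {b : Module.Basis ι ℂ V}
  {θ : ι → G → ℂ}

lemma repr_apply_of_diagonal (hθ : ∀ w ∈ I, ∀ x, ρ w (b x) = θ x w • b x) {w : G} (hw : w ∈ I)
    (v : V) (y : ι) : b.repr (ρ w v) y = θ y w * b.repr v y := by
  have : Finsupp.lapply y ∘ₗ b.repr.toLinearMap ∘ₗ ρ w =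
      θ y w • Finsupp.lapply y ∘ₗ b.repr.toLinearMap := by
    refine b.ext fun x => ?_
    simp only [LinearMap.comp_apply, hθ w hw, LinearMap.smul_apply]
    by_cases hxy : x = y <;> simp [hxy]
  exact LinearMap.congr_fun this v

lemma eq_of_repr_ne_zero (hθ : ∀ w ∈ I, ∀ x, ρ w (b x) = θ x w • b x) {χ : G → ℂ} {v : V}
    (hv : ∀ w ∈ I, ρ w v = χ w • v) {y : ι} (hy : b.repr v y ≠ 0) {w : G} (hw : w ∈ I) :
    χ w = θ y w := by
  have h := repr_apply_of_diagonal hθ hw v y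
  rw [hv w hw] at h
  exact mul_right_cancel₀ hy (by simpa using h)

/-- A nonzero subspace stable under a group acting on the vectors of a basis by distinct characters
contains one of these vectors. -/
lemma exists_basis_mem_of_stable [Finite ι] (hθ : ∀ w ∈ I, ∀ x, ρ w (b x) = θ x w • b x)
    (hsep : ∀ x y, x ≠ y → ∃ w ∈ I, θ x w ≠ θ y w) {W : Submodule ℂ V}
    (hW : ∀ w ∈ I, ∀ v ∈ W, ρ w v ∈ W) (hne : W ≠ ⊥) : ∃ x, b x ∈ W := by
  obtain ⟨v₀, hv₀, hv₀ne⟩ := W.ne_bot_iff.mp hne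
  -- a nonzero vector of `W` with minimal support is a multiple of a basis vector
  let P : ℕ → Prop := fun m => ∃ v ∈ W, v ≠ 0 ∧ (b.repr v).support.card = m
  have hP : ∃ m, P m := ⟨_, v₀, hv₀, hv₀ne, rfl⟩
  classical
  obtain ⟨v, hv, hvne, hcard⟩ := Nat.find_spec hP
  obtain ⟨x, hx⟩ : ∃ x, b.repr v x ≠ 0 := by
    by_contra! h
    exact hvne (b.repr.map_eq_zero_iff.mp (Finsupp.ext h))
  have honly : ∀ y, y ≠ x → b.repr v y = 0 := by
    intro y hyx
    by_contra hy
    obtain ⟨w, hw, hne'⟩ := hsep y x hyx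
    set v' := ρ w v - θ x w • v with hv'
    have hrepr : ∀ z, b.repr v' z = (θ z w - θ x w) * b.repr v z := by
      intro z
      rw [hv', map_sub, Finsupp.sub_apply, repr_apply_of_diagonal hθ hw, map_smul,
        Finsupp.smul_apply, smul_eq_mul, sub_mul]
    have hlt : (b.repr v').support.card < Nat.find hP := by
      rw [← hcard]
      refine Finset.card_lt_card ⟨fun z hz => ?_, fun hsub => ?_⟩
      · rw [Finsupp.mem_support_iff] at hz ⊢
        intro h0
        exact hz (by rw [hrepr, h0, mul_zero])
      · have := hsub (Finsupp.mem_support_iff.mpr hx)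
        rw [Finsupp.mem_support_iff, hrepr, sub_self, zero_mul] at this
        exact this rfl
    refine Nat.find_min hP hlt ⟨v', W.sub_mem (hW w hw v hv) (W.smul_mem _ hv), fun h0 => ?_, rfl⟩
    have := hrepr y
    rw [h0, map_zero, Finsupp.zero_apply] at this
    exact mul_ne_zero (sub_ne_zero.mpr hne') hy this.symm
  have hvx : v = b.repr v x • b x := by
    apply b.repr.injective
    ext y
    by_cases hyx : y = x
    · simp [hyx]
    · rw [honly y hyx]
      simp [Ne.symm hyx]
  refine ⟨x, ?_⟩
  rw [hvx] at hv
  exact (W.smul_mem_iff hx).mp hv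

/-- A representation with a basis on which a subgroup acts by distinct characters, and whose lines
are permuted transitively, is irreducible. -/
theorem isIrreducible_of_monomial [Finite ι] [Nonempty ι]
    (hθ : ∀ w ∈ I, ∀ x, ρ w (b x) = θ x w • b x)
    (hsep : ∀ x y, x ≠ y → ∃ w ∈ I, θ x w ≠ θ y w)
    (htrans : ∀ x y, ∃ (g : G) (c : ℂ), c ≠ 0 ∧ ρ g (b x) = c • b y) : ρ.IsIrreducible where
  exists_pair_ne := by
    refine ⟨⊥, ⊤, fun h => ?_⟩
    have hmem : b (Classical.arbitrary ι) ∈ (⊤ : Subrepresentation ρ).toSubmodule :=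
      Submodule.mem_top
    rw [← h] at hmem
    exact b.ne_zero _ ((Submodule.mem_bot ℂ).mp hmem)
  eq_bot_or_eq_top W := by
    by_cases hW : W.toSubmodule = ⊥
    · exact Or.inl (Subrepresentation.toSubmodule_injective hW)
    · right
      obtain ⟨x, hx⟩ := exists_basis_mem_of_stable hθ hsep
        (fun w _ v hv => W.apply_mem_toSubmodule w hv) hW
      apply Subrepresentation.toSubmodule_injective
      change W.toSubmodule = ⊤
      rw [eq_top_iff, ← b.span_eq, Submodule.span_le]
      rintro _ ⟨y, rfl⟩
      obtain ⟨g, c, hc, hg⟩ := htrans x y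
      have := W.apply_mem_toSubmodule g hx
      rw [hg] at this
      exact (W.toSubmodule.smul_mem_iff hc).mp this

/-- An element normalizing `I` permutes the eigenlines of `I`. -/
lemma exists_perm_of_normal [Finite ι] [I.Normal]
    (hθ : ∀ w ∈ I, ∀ x, ρ w (b x) = θ x w • b x)
    (hsep : ∀ x y, x ≠ y → ∃ w ∈ I, θ x w ≠ θ y w) (g : G) :
    ∃ (σ : Equiv.Perm ι) (a : ι → ℂ), (∀ x, a x ≠ 0) ∧ ∀ x, ρ g (b x) = a x • b (σ x) := by
  have hinj : Function.Injective (ρ g) := fun v w h => by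
    rw [← ρ.inv_self_apply g v, h, ρ.inv_self_apply]
  have hex : ∀ x, ∃ (y : ι) (a : ℂ), a ≠ 0 ∧ ρ g (b x) = a • b y := by
    intro x
    have heig : ∀ w ∈ I, ρ w (ρ g (b x)) = θ x (g⁻¹ * w * g) • ρ g (b x) := by
      intro w hw
      have hw' : g⁻¹ * w * g ∈ I := by
        simpa using (inferInstance : I.Normal).conj_mem w hw g⁻¹
      rw [← map_smul, ← hθ _ hw', ← Module.End.mul_apply, ← Module.End.mul_apply, ← map_mul,
        ← map_mul]
      congr 2
      group
    have hne : ρ g (b x) ≠ 0 := fun h => b.ne_zero x (hinj (by rw [h, map_zero]))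
    obtain ⟨y, hy⟩ : ∃ y, b.repr (ρ g (b x)) y ≠ 0 := by
      by_contra! h
      exact hne (b.repr.map_eq_zero_iff.mp (Finsupp.ext h))
    refine ⟨y, b.repr (ρ g (b x)) y, hy, b.repr.injective (Finsupp.ext fun z => ?_)⟩
    by_cases hzy : z = y
    · simp [hzy]
    · simp only [map_smul, Module.Basis.repr_self, Finsupp.smul_apply,
        Finsupp.single_eq_of_ne hzy, smul_zero]
      by_contra hz
      obtain ⟨w, hw, hne'⟩ := hsep z y hzy
      exact hne' ((eq_of_repr_ne_zero hθ heig hz hw).symm.trans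
        (eq_of_repr_ne_zero hθ heig hy hw))
  choose σ a ha hσ using hex
  have hσinj : Function.Injective σ := by
    intro x y hxy
    have h1 : ρ g (a y • b x) = ρ g (a x • b y) := by
      rw [map_smul, map_smul, hσ, hσ, hxy, smul_comm]
    have h2 := hinj h1
    by_contra hne
    have h3 := congrArg (fun v => b.repr v x) h2
    simp [hne, ha y] at h3
  exact ⟨Equiv.ofBijective σ (Finite.injective_iff_bijective.mp hσinj), a, ha, hσ⟩

lemma exists_pow_smul {g : G} {σ : Equiv.Perm ι} {a : ι → ℂ} (ha : ∀ x, a x ≠ 0)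
    (hσ : ∀ x, ρ g (b x) = a x • b (σ x)) (j : ℕ) (x : ι) :
    ∃ c : ℂ, c ≠ 0 ∧ ρ (g ^ j) (b x) = c • b (σ^[j] x) := by
  induction j with
  | zero => exact ⟨1, one_ne_zero, by simp⟩
  | succ j ih =>
    obtain ⟨c, hc, h⟩ := ih
    refine ⟨c * a (σ^[j] x), mul_ne_zero hc (ha _), ?_⟩
    rw [pow_succ', map_mul, Module.End.mul_apply, h, map_smul, hσ, smul_smul,
      Function.iterate_succ_apply']

/-- The stabilizer of the line spanned by `v`. -/
def lineStabilizer (ρ : Representation ℂ G V) (v : V) : Subgroup G where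
  carrier := {g | ∃ c : ℂˣ, ρ g v = (c : ℂ) • v}
  one_mem' := ⟨1, by simp⟩
  mul_mem' := by
    rintro g h ⟨c, hc⟩ ⟨d, hd⟩
    exact ⟨c * d, by rw [map_mul, Module.End.mul_apply, hd, map_smul, hc, smul_smul, mul_comm,
      Units.val_mul]⟩
  inv_mem' := by
    rintro g ⟨c, hc⟩
    refine ⟨c⁻¹, ?_⟩
    have h : (c : ℂ) • ρ g⁻¹ v = v := by rw [← map_smul, ← hc, ρ.inv_self_apply]
    conv_rhs => rw [← h]
    rw [smul_smul, ← Units.val_mul, inv_mul_cancel, Units.val_one, one_smul]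

/-- A subgroup stabilizing the line spanned by `v` acts on it by a character. -/
lemma exists_char_of_le_lineStabilizer {v : V} (hv : v ≠ 0) {H : Subgroup G}
    (hH : H ≤ lineStabilizer ρ v) : ∃ η : H →* ℂˣ, ∀ h : H, ρ h v = (η h : ℂ) • v := by
  choose c hc using fun h : H => hH h.2
  have huniq : ∀ a a' : ℂˣ, (a : ℂ) • v = (a' : ℂ) • v → a = a' := fun a a' h =>
    Units.ext (smul_left_injective ℂ hv h)
  refine ⟨⟨⟨c, huniq _ _ ?_⟩, fun g h => huniq _ _ ?_⟩, hc⟩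
  · rw [← hc]; simp
  · rw [← hc, Subgroup.coe_mul, map_mul, Module.End.mul_apply, hc, map_smul, hc, smul_smul,
      mul_comm, Units.val_mul]

end MonomialRepresentations

/-! ### Orbits stable under an involution -/

section Orbits

/-- If every orbit of the permutation `σ` is stable under a fixed-point free involution `τ`
commuting with `σ`, then it has even length `2 d`, and `τ` acts on it as `σ ^ d`. -/
theorem exists_orbit_representatives {ι : Type*} [Finite ι] (σ : Equiv.Perm ι) {τ : ι → ι}
    (hττ : ∀ x, τ (τ x) = x) (hτ : ∀ x, τ x ≠ x) (hcomm : ∀ x, σ (τ x) = τ (σ x))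
    (hcyc : ∀ x, σ.SameCycle x (τ x)) :
    ∃ (s : ℕ) (d : Fin s → ℕ) (r : Fin s → ι), (∀ i, 0 < d i) ∧
      (∀ i, σ^[d i] (r i) = τ (r i)) ∧ (∀ i, σ^[2 * d i] (r i) = r i) ∧
      Function.Bijective fun p : Σ i, Fin (2 * d i) => σ^[(p.2 : ℕ)] (r p.1) := by
  classical
  have := Fintype.ofFinite ι
  have hcomm' : ∀ (j : ℕ) x, σ^[j] (τ x) = τ (σ^[j] x) := by
    intro j x
    induction j with
    | zero => rfl
    | succ j ih => rw [Function.iterate_succ_apply', Function.iterate_succ_apply', ih, hcomm]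
  have hhalf : ∀ x, ∃ d, 0 < d ∧ σ^[d] x = τ x ∧ Function.minimalPeriod σ x = 2 * d := by
    intro x
    obtain ⟨j, hj⟩ : ∃ j : ℕ, σ^[j] x = τ x := by
      obtain ⟨j, -, hj⟩ := (hcyc x).exists_pow_eq'
      exact ⟨j, by rw [Equiv.Perm.iterate_eq_pow]; exact hj⟩
    set m := Function.minimalPeriod σ x with hm
    have hper : ∀ k, σ^[k] x = τ x → m ∣ 2 * k := by
      intro k hk
      apply Function.IsPeriodicPt.minimalPeriod_dvd
      change σ^[2 * k] x = x
      rw [two_mul, Function.iterate_add_apply, hk, hcomm', hk, hττ]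
    have hj0 : 0 < j := Nat.pos_of_ne_zero fun h => hτ x (by rw [← hj, h]; rfl)
    have hm0 : 0 < m := Nat.pos_of_dvd_of_pos (hper j hj) (by omega)
    have hd : σ^[j % m] x = τ x := by rw [Function.iterate_mod_minimalPeriod_eq, hj]
    have hd0 : 0 < j % m := Nat.pos_of_ne_zero fun h => hτ x (by rw [← hd, h]; rfl)
    have hlt := Nat.mod_lt j hm0
    obtain ⟨q, hq⟩ := hper _ hd
    refine ⟨j % m, hd0, hd, ?_⟩
    have hq1 : q = 1 := by
      have h2 : q < 2 := by
        by_contra! h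
        have := Nat.mul_le_mul_left m h
        omega
      have h0 : q ≠ 0 := by rintro rfl; omega
      omega
    rw [hq, hq1, mul_one]
  let Q := Quotient (Equiv.Perm.SameCycle.setoid σ)
  let E : Fin (Fintype.card Q) ≃ Q := (Fintype.equivFin Q).symm
  let r : Fin (Fintype.card Q) → ι := fun i => (E i).out
  choose d hd0 hd hper using fun i => hhalf (r i)
  have hr : ∀ i (j : ℕ), (Quotient.mk (Equiv.Perm.SameCycle.setoid σ) (σ^[j] (r i))) = E i := by
    intro i j
    rw [← Quotient.out_eq (E i)]
    apply Quotient.sound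
    change σ.SameCycle (σ^[j] (r i)) (r i)
    rw [Equiv.Perm.iterate_eq_pow, Equiv.Perm.sameCycle_pow_left]
  refine ⟨_, d, r, hd0, hd, fun i => ?_, ?_, ?_⟩
  · rw [← hper]; exact Function.iterate_minimalPeriod
  · rintro ⟨i, j⟩ ⟨i', j'⟩ h
    simp only at h
    obtain rfl : i = i' := E.injective (by rw [← hr i j, ← hr i' j', h])
    congr 1
    apply Fin.ext
    exact Function.iterate_injOn_Iio_minimalPeriod (f := σ) (x := r i)
      (by rw [hper]; exact j.2) (by rw [hper]; exact j'.2) h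
  · intro y
    obtain ⟨i, hi⟩ := E.surjective (Quotient.mk _ y)
    have hsame : σ.SameCycle (r i) y := by
      have h1 : Quotient.mk (Equiv.Perm.SameCycle.setoid σ) (r i) = Quotient.mk _ y := by
        rw [← hi]; exact hr i 0
      exact Quotient.exact h1
    obtain ⟨j, -, hj⟩ := hsame.exists_pow_eq'
    rw [← Equiv.Perm.iterate_eq_pow] at hj
    refine ⟨⟨i, j % (2 * d i), Nat.mod_lt _ (by have := hd0 i; omega)⟩, ?_⟩
    simp only
    rw [← hper, Function.iterate_mod_minimalPeriod_eq, hj]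

end Orbits

/-! ### Decomposition into induced representations -/

section Decomposition

variable {G : Type*} [Group G] {V : Type*} [AddCommGroup V] [Module ℂ V]
  {ρ : Representation ℂ G V}

/-- If `H` acts on `v` by `η`, then it acts on `g v` by the conjugate of `η` by `g`. -/
lemma conjChar_apply_smul {H : Subgroup G} [H.Normal] {η : H →* ℂˣ} {v : V}
    (hη : ∀ h : H, ρ h v = (η h : ℂ) • v) (g : G) (h : H) :
    ρ h (ρ g v) = (conjChar g η h : ℂ) • ρ g v := by
  have h1 := hη (MulAut.conjNormal g⁻¹ h)
  change _ = (conjChar g η h : ℂ) • v at h1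
  rw [← map_smul, ← h1, ← Module.End.mul_apply, ← Module.End.mul_apply, ← map_mul, ← map_mul,
    MulAut.conjNormal_apply]
  congr 2
  group

/-- The powers `g ^ (-j)`, `0 ≤ j < m`, represent all cosets of `I ⟨g ^ m⟩`, if `G = I ⟨g⟩`. -/
lemma exists_eq_mul_inv_pow {I : Subgroup G} [I.Normal] {g : G}
    (hI : I ⊔ Subgroup.zpowers g = ⊤) {m : ℕ} (hm : 0 < m) (x : G) :
    ∃ h ∈ I ⊔ Subgroup.zpowers (g ^ m), ∃ j : Fin m, x = h * (g ^ (j : ℕ))⁻¹ := by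
  have hx : x ∈ I ⊔ Subgroup.zpowers g := hI ▸ Subgroup.mem_top x
  rw [← SetLike.mem_coe, Subgroup.normal_mul] at hx
  obtain ⟨w, hw, _, ⟨k, rfl⟩, rfl⟩ := hx
  have hm' : (0 : ℤ) < m := by exact_mod_cast hm
  have h0 := Int.emod_nonneg (-k) hm'.ne'
  have h1 := Int.emod_lt_of_pos (-k) hm'
  have h2 := Int.mul_ediv_add_emod (-k) m
  refine ⟨w * (g ^ m) ^ (-((-k) / m)), Subgroup.mul_mem_sup hw (Subgroup.zpow_mem_zpowers _ _),
    ⟨((-k) % m).toNat, by omega⟩, ?_⟩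
  simp only
  rw [mul_assoc, ← zpow_natCast g m, ← zpow_mul, ← zpow_natCast, ← zpow_neg, ← zpow_add,
    Int.toNat_of_nonneg h0]
  congr 2
  linarith

/-- Let `G = I ⟨fr⟩` act by symplectic similitudes on a space with a basis `b` on which `I` acts by
distinct characters `θ`, and let `τ` be the duality of the lines of `b` under `ω`. If `fr` permutes
the lines so that dual lines lie in the same orbit, then the representation is the orthogonal sum of
pairwise inequivalent irreducible symplectic representations, induced from characters of the groups
`I ⟨fr ^ (2 d)⟩`. These groups enter as a family `H` with a defining equation. -/
theorem exists_symplectic_decomposition {I : Subgroup G} [I.Normal] {fr : G}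
    (hI : I ⊔ Subgroup.zpowers fr = ⊤) (H : ℕ → Subgroup G) [∀ m, (H m).Normal]
    (hH : ∀ m, H m = I ⊔ Subgroup.zpowers (fr ^ m)) {ι : Type*} [Fintype ι]
    (b : Module.Basis ι ℂ V) {θ : ι → G → ℂ} (hθ : ∀ w ∈ I, ∀ x, ρ w (b x) = θ x w • b x)
    (hsep : ∀ x y, x ≠ y → ∃ w ∈ I, θ x w ≠ θ y w) {ω : LinearMap.BilinForm ℂ V}
    (halt : ω.IsAlt) (hnd : ∀ v, (∀ w, ω v w = 0) → v = 0) {lam : G →* ℂˣ}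
    (hsim : ∀ g v w, ω (ρ g v) (ρ g w) = (lam g : ℂ) * ω v w) {τ : ι → ι}
    (hb : ∀ x y, ω (b x) (b y) ≠ 0 ↔ y = τ x)
    (hcyc : ∀ (σ : Equiv.Perm ι) (a : ι → ℂ), (∀ x, ρ fr (b x) = a x • b (σ x)) →
      (∀ x, σ (τ x) = τ (σ x)) → ∀ x, σ.SameCycle x (τ x)) :
    ∃ (s : ℕ) (d : Fin s → ℕ) (v : Fin s → V) (η : ∀ i, H (2 * d i) →* ℂˣ),
      (∀ i, 0 < d i) ∧ 2 * ∑ i, d i = Fintype.card ι ∧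
      (∀ i, ∃ x, v i = b x) ∧ (∀ i (h : H (2 * d i)), ρ h (v i) = (η i h : ℂ) • v i) ∧
      (∀ i, ∀ j < 2 * d i, ∀ k < 2 * d i, j ≠ k →
        conjChar (fr ^ j) (η i) ≠ conjChar (fr ^ k) (η i)) ∧
      (∀ i h, η i h * conjChar (fr ^ d i) (η i) h = lam h) ∧
      (∀ i hmem, η i ⟨fr ^ (2 * d i), hmem⟩ = -lam (fr ^ d i)) ∧
      (∀ i, (indRep (η i)).IsIrreducible) ∧
      (∀ i j, i ≠ j → ∀ m : ℕ, ∃ (w : G) (hi : w ∈ H (2 * d i)) (hj : w ∈ H (2 * d j)),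
          η i ⟨w, hi⟩ ≠ conjChar (fr ^ m) (η j) ⟨w, hj⟩) ∧
      (∀ i j, i ≠ j → IsEmpty ((indRep (η i)).Equiv (indRep (η j)))) ∧
      ∃ B : ∀ i, LinearMap.BilinForm ℂ (IndSpace (η i)),
        (∀ i, IsSymplecticFormFor (indRep (η i)) lam (B i)) ∧
        ∃ e : (∀ i, IndSpace (η i)) ≃ₗ[ℂ] V,
          (∀ (g : G) (x : ∀ i, IndSpace (η i)),
            e (fun i => indRep (η i) g (x i)) = ρ g (e x)) ∧
          (∀ x y : ∀ i, IndSpace (η i), ω (e x) (e y) = ∑ i, B i (x i) (y i)) := by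
  classical
  obtain ⟨σ, a, ha, hσ⟩ := exists_perm_of_normal hθ hsep fr
  have hττ : ∀ x, τ (τ x) = x := fun x => by
    have h1 : ω (b x) (b (τ x)) ≠ 0 := (hb _ _).mpr rfl
    refine ((hb _ _).mp ?_).symm
    rw [← halt.neg_eq]
    exact neg_ne_zero.mpr h1
  have hτ : ∀ x, τ x ≠ x := fun x hx => (hb x x).mpr hx.symm (halt.self_eq_zero _)
  have hcomm : ∀ x, σ (τ x) = τ (σ x) := fun x => by
    rw [← hb]
    intro h0
    have h1 := hsim fr (b x) (b (τ x))
    rw [hσ, hσ] at h1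
    simp only [map_smul, LinearMap.smul_apply, h0, smul_zero] at h1
    exact mul_ne_zero (lam fr).ne_zero ((hb _ _).mpr rfl) h1.symm
  obtain ⟨s, d, r, hd0, hdr, hper, hbij⟩ :=
    exists_orbit_representatives σ hττ hτ hcomm (hcyc σ a hσ hcomm)
  have hinjr : ∀ i j (k l : ℕ), k < 2 * d i → l < 2 * d j → σ^[k] (r i) = σ^[l] (r j) →
      i = j ∧ k = l := by
    intro i j k l hk hl h
    have := hbij.1 (a₁ := ⟨i, k, hk⟩) (a₂ := ⟨j, l, hl⟩) h
    obtain ⟨rfl, h2⟩ := Sigma.mk.inj_iff.mp this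
    exact ⟨rfl, congrArg Fin.val (eq_of_heq h2)⟩
  have hIH : ∀ m, I ≤ H m := fun m => hH m ▸ le_sup_left
  have hstab : ∀ i, H (2 * d i) ≤ lineStabilizer ρ (b (r i)) := by
    intro i
    rw [hH, sup_le_iff, Subgroup.zpowers_le]
    constructor
    · intro w hw
      refine ⟨Units.mk0 (θ (r i) w) fun h0 => b.ne_zero (r i) ?_, hθ w hw _⟩
      rw [← ρ.inv_self_apply w (b (r i)), hθ w hw, h0, zero_smul, map_zero]
    · obtain ⟨c, hc, h⟩ := exists_pow_smul ha hσ (2 * d i) (r i)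
      exact ⟨Units.mk0 c hc, by rw [h, hper]; rfl⟩
  choose η hη using fun i => exists_char_of_le_lineStabilizer (b.ne_zero (r i)) (hstab i)
  -- the conjugates of `η i`, restricted to `I`, are the characters on the lines of the orbit
  have hconj : ∀ i (m : ℕ) w (hw : w ∈ I) (hw' : w ∈ H (2 * d i)),
      (conjChar (fr ^ m) (η i) ⟨w, hw'⟩ : ℂ) = θ (σ^[m] (r i)) w := by
    intro i m w hw hw'
    obtain ⟨c, hc, h⟩ := exists_pow_smul ha hσ m (r i)
    have h1 := conjChar_apply_smul (hη i) (fr ^ m) ⟨w, hw'⟩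
    rw [h] at h1
    simp only [map_smul, hθ w hw] at h1
    rw [smul_comm] at h1
    exact (smul_left_injective ℂ (smul_ne_zero hc (b.ne_zero _)) h1).symm
  have hηθ : ∀ i w (hw : w ∈ I) (hw' : w ∈ H (2 * d i)), (η i ⟨w, hw'⟩ : ℂ) = θ (r i) w := by
    intro i w hw hw'
    have h1 := hη i ⟨w, hw'⟩
    rw [hθ w hw] at h1
    exact (smul_left_injective ℂ (b.ne_zero _) h1).symm
  -- a power of `fr` moves each line of an orbit to the line dual to it
  have hdual : ∀ i, ω (b (r i)) (ρ (fr ^ d i) (b (r i))) ≠ 0 := by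
    intro i
    obtain ⟨c, hc, h⟩ := exists_pow_smul ha hσ (d i) (r i)
    rw [h, hdr, map_smul]
    exact smul_ne_zero hc ((hb _ _).mpr rfl)
  choose c hc0 hc using fun p : Σ i, Fin (2 * d i) => exists_pow_smul ha hσ (p.2 : ℕ) (r p.1)
  let f : Module.Basis (Σ i, Fin (2 * d i)) ℂ V :=
    (b.reindex (Equiv.ofBijective _ hbij).symm).isUnitSMul fun p => (hc0 p).isUnit
  have hf : ∀ p, f p = c p • b (σ^[(p.2 : ℕ)] (r p.1)) := fun p => by
    simp [f, Module.Basis.isUnitSMul_apply]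
  let t : ∀ i, Fin (2 * d i) → G := fun i j => (fr ^ (j : ℕ))⁻¹
  have ht : ∀ i g, ∃ (h : H (2 * d i)) (j : Fin (2 * d i)), g = h * t i j := by
    intro i g
    obtain ⟨h, hh, j, hj⟩ := exists_eq_mul_inv_pow hI (m := 2 * d i)
      (by have := hd0 i; omega) g
    exact ⟨⟨h, by rw [hH]; exact hh⟩, j, hj⟩
  have hft : ∀ i j, ρ (t i j)⁻¹ (b (r i)) = f ⟨i, j⟩ := fun i j => by
    rw [hf, inv_inv, hc ⟨i, j⟩]
  have hli : ∀ i, LinearIndependent ℂ fun j => ρ (t i j)⁻¹ (b (r i)) := by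
    intro i
    simp only [hft]
    exact f.linearIndependent.comp _ sigma_mk_injective
  let U := fun i => indBasis (η i) ρ (b (r i)) (hη i) (t i) (ht i) (hli i)
  have hU : ∀ i j, U i j = indVec (η i) (t i j) := fun i j => indBasis_apply ..
  let L := fun i => indLift (η i) ρ (b (r i)) (hη i)
  have hL : ∀ i j, L i (U i j) = f ⟨i, j⟩ := fun i j => by
    rw [hU, ← hft]; exact indLift_indVec ..
  let e : (∀ i, IndSpace (η i)) ≃ₗ[ℂ] V := (Pi.basis U).equiv f (Equiv.refl _)
  have he : ∀ x, e x = ∑ i, L i (x i) := by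
    have : e.toLinearMap = ∑ i, L i ∘ₗ LinearMap.proj i := by
      refine (Pi.basis U).ext fun p => ?_
      rw [LinearEquiv.coe_coe, Module.Basis.equiv_apply, Equiv.refl_apply, LinearMap.sum_apply,
        Finset.sum_eq_single p.1]
      · simp [hL]
      · intro i _ hi
        simp [Pi.basis_apply, Pi.single_eq_of_ne hi]
      · simp
    intro x
    exact (LinearMap.congr_fun this x).trans (by simp)
  have heq : ∀ (g : G) (x : ∀ i, IndSpace (η i)),
      e (fun i => indRep (η i) g (x i)) = ρ g (e x) := by
    intro g x
    rw [he, he, map_sum]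
    exact Finset.sum_congr rfl fun i _ => indLift_indRep ..
  have hLinj : ∀ i, Function.Injective (L i) := by
    intro i x y hxy
    have h1 : ∀ z, e (Pi.single i z) = L i z := by
      intro z
      rw [he, Finset.sum_eq_single i]
      · rw [Pi.single_eq_same]
      · intro j _ hj
        rw [Pi.single_eq_of_ne hj, map_zero]
      · simp
    rw [← h1, ← h1] at hxy
    exact Pi.single_injective i (e.injective hxy)
  have hUθ : ∀ i, ∀ w ∈ I, ∀ j : Fin (2 * d i),
      indRep (η i) w (U i j) = θ (σ^[(j : ℕ)] (r i)) w • U i j := by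
    intro i w hw j
    apply hLinj i
    rw [map_smul, hL, hf]
    refine (indLift_indRep ..).trans ?_
    change ρ w (L i (U i j)) = _
    rw [hL, hf, map_smul, hθ w hw, smul_comm]
  -- different summands are orthogonal, since `τ` preserves orbits
  have horth : ∀ i j, i ≠ j → ∀ x y, ω (L i x) (L j y) = 0 := by
    intro i j hij x y
    have : ω.compl₁₂ (L i) (L j) = 0 := by
      refine (U i).ext fun k => (U j).ext fun l => ?_
      simp only [LinearMap.compl₁₂_apply, hL, hf, map_smul, LinearMap.smul_apply,
        LinearMap.zero_apply]
      have h0 : ω (b (σ^[(k : ℕ)] (r i))) (b (σ^[(l : ℕ)] (r j))) = 0 := by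
        by_contra hne
        have h1 := (hb _ _).mp hne
        have h2 : τ (σ^[(k : ℕ)] (r i)) = σ^[(k + d i) % (2 * d i)] (r i) := by
          have hP : Function.IsPeriodicPt σ (2 * d i) (r i) := hper i
          rw [hP.iterate_mod_apply, Function.iterate_add_apply, hdr]
          exact (Function.Semiconj.iterate_right (f := τ) (ga := σ) (gb := σ)
            (fun x => (hcomm x).symm) k (r i))
        rw [h2] at h1
        exact hij (hinjr i j _ l (Nat.mod_lt _ (by have := hd0 i; omega)) l.2 h1.symm).1
      rw [h0, smul_zero, smul_zero]
    exact LinearMap.congr_fun₂ this x y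
  have hform : ∀ x y : ∀ i, IndSpace (η i),
      ω (e x) (e y) = ∑ i, ω.compl₁₂ (L i) (L i) (x i) (y i) := by
    intro x y
    rw [he, he, map_sum]
    refine Finset.sum_congr rfl fun i _ => ?_
    rw [map_sum, LinearMap.sum_apply, Finset.sum_eq_single i]
    · rfl
    · exact fun j _ hj => horth j i hj _ _
    · simp
  refine ⟨s, d, fun i => b (r i), η, hd0, ?_, fun i => ⟨r i, rfl⟩, hη, ?_, ?_, ?_, ?_, ?_, ?_,
    fun i => ω.compl₁₂ (L i) (L i), ?_, e, heq, hform⟩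
  · rw [← Fintype.card_of_bijective hbij, Fintype.card_sigma, Finset.mul_sum]
    simp
  · intro i j hj k hk hjk h
    have hne : σ^[j] (r i) ≠ σ^[k] (r i) := fun h' => hjk (hinjr i i j k hj hk h').2
    obtain ⟨w, hw, hwne⟩ := hsep _ _ hne
    rw [← hconj i j w hw (hIH _ hw), ← hconj i k w hw (hIH _ hw), h] at hwne
    exact hwne rfl
  · intro i h
    have h1 := hsim h (b (r i)) (ρ (fr ^ d i) (b (r i)))
    rw [hη, conjChar_apply_smul (hη i)] at h1
    simp only [map_smul, LinearMap.smul_apply, smul_eq_mul] at h1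
    apply Units.ext
    apply mul_right_cancel₀ (hdual i)
    rw [← h1, Units.val_mul]
    ring
  · intro i hmem
    -- compare the values of `ω` on `(v, fr ^ d v)` and on its image under `fr ^ d`, which is
    -- `(fr ^ d v, η(fr ^ (2 d)) v)`, for `v = b (r i)`
    have h1 := hsim (fr ^ d i) (b (r i)) (ρ (fr ^ d i) (b (r i)))
    have h2 := hη i ⟨fr ^ (2 * d i), hmem⟩
    simp only [two_mul, pow_add, map_mul, Module.End.mul_apply] at h2
    rw [h2, map_smul, ← halt.neg_eq] at h1
    apply Units.ext
    apply mul_right_cancel₀ (hdual i)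
    rw [Units.val_neg, neg_mul, ← h1, smul_eq_mul]
    simp only [two_mul, pow_add, mul_neg, neg_neg]
  · intro i
    have : Nonempty (Fin (2 * d i)) := ⟨⟨0, by have := hd0 i; omega⟩⟩
    refine isIrreducible_of_monomial (b := U i)
      (θ := fun j w => θ (σ^[(j : ℕ)] (r i)) w) (hUθ i) (fun j k hjk => ?_) fun j k => ?_
    · exact hsep _ _ fun h => hjk (Fin.ext (hinjr i i j k j.2 k.2 h).2)
    · refine ⟨fr ^ (k : ℕ) * (fr ^ (j : ℕ))⁻¹, 1, one_ne_zero, ?_⟩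
      rw [hU, hU, indRep_indVec, one_smul]
      congr 1
      simp [t]
  · intro i j hij m
    have hne : r i ≠ σ^[m] (r j) := by
      intro h
      have hP : Function.IsPeriodicPt σ (2 * d j) (r j) := hper j
      rw [← hP.iterate_mod_apply m] at h
      exact hij (hinjr i j 0 _ (by have := hd0 i; omega)
        (Nat.mod_lt _ (by have := hd0 j; omega)) h).1
    obtain ⟨w, hw, hwne⟩ := hsep _ _ hne
    refine ⟨w, hIH _ hw, hIH _ hw, fun h => hwne ?_⟩
    rw [← hηθ i w hw (hIH _ hw), ← hconj j m w hw (hIH _ hw), h]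
  · refine fun i j hij => ⟨fun T => ?_⟩
    -- the image of an eigenvector of `I` would have the character of a line in another orbit
    let k₀ : Fin (2 * d i) := ⟨0, by have := hd0 i; omega⟩
    have hT : ∀ w ∈ I, indRep (η j) w (T (U i k₀)) = θ (r i) w • T (U i k₀) := by
      intro w hw
      have h1 : indRep (η i) w (U i k₀) = θ (r i) w • U i k₀ := hUθ i w hw k₀
      rw [← map_smul, ← h1]
      exact (Representation.IntertwiningMap.isIntertwining _ _ T.toIntertwiningMap w (U i k₀)).symm
    have hT0 : T (U i k₀) ≠ 0 := fun h => (U i).ne_zero k₀ (by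
      rw [← T.symm_apply_apply (U i k₀), h, map_zero])
    obtain ⟨l, hl⟩ : ∃ l, (U j).repr (T (U i k₀)) l ≠ 0 := by
      by_contra! h
      exact hT0 ((U j).repr.map_eq_zero_iff.mp (Finsupp.ext h))
    have hne : r i ≠ σ^[(l : ℕ)] (r j) := fun h =>
      hij (hinjr i j 0 l k₀.2 l.2 h).1
    obtain ⟨w, hw, hwne⟩ := hsep _ _ hne
    exact hwne (eq_of_repr_ne_zero (b := U j)
      (θ := fun l w => θ (σ^[(l : ℕ)] (r j)) w) (hUθ j) hT hl hw)
  · intro i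
    have hBalt : (ω.compl₁₂ (L i) (L i)).IsAlt := fun x => halt.self_eq_zero _
    refine ⟨hBalt, ?_, ?_⟩
    · refine hBalt.isRefl.nondegenerate_iff_separatingLeft.mpr fun x hx => ?_
      apply hLinj i
      rw [map_zero]
      apply hnd
      intro w
      obtain ⟨y, rfl⟩ := e.surjective w
      rw [he, map_sum]
      refine Finset.sum_eq_zero fun j _ => ?_
      by_cases hij : i = j
      · subst hij; exact hx _
      · exact horth i j hij _ _
    · intro g x y
      simp only [LinearMap.compl₁₂_apply, L]
      rw [indLift_indRep, indLift_indRep, hsim]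

end Decomposition

/-! ### Transvections and the diagonal torus -/

section Transvections

variable {n : ℕ}

/-- The symplectic transformation `v ↦ v + ⟨v, u⟩ w + ⟨v, w⟩ u` attached to orthogonal vectors
`u` and `w`, which may be equal. -/
def symplecticTransvection (u w : Fin n ⊕ Fin n → ℂ) (huw : stdSymplecticForm n u w = 0) : GSp n :=
  GSp.ofLinear (LinearMap.id + (LinearMap.toSpanSingleton ℂ _ w) ∘ₗ (stdSymplecticForm n).flip u +
    (LinearMap.toSpanSingleton ℂ _ u) ∘ₗ (stdSymplecticForm n).flip w) 1 (by
    intro v v'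
    have hwu : stdSymplecticForm n w u = 0 := by
      rw [← stdSymplecticForm_isAlt.neg_eq, huw, neg_zero]
    have h1 : stdSymplecticForm n u v' = -stdSymplecticForm n v' u :=
      (stdSymplecticForm_isAlt.neg_eq v' u).symm
    have h2 : stdSymplecticForm n w v' = -stdSymplecticForm n v' w :=
      (stdSymplecticForm_isAlt.neg_eq v' w).symm
    simp [huw, hwu, h1, h2, stdSymplecticForm_isAlt.self_eq_zero]
    ring)

lemma mat_symplecticTransvection_mulVec (u w : Fin n ⊕ Fin n → ℂ)
    (huw : stdSymplecticForm n u w = 0) (v : Fin n ⊕ Fin n → ℂ) :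
    GSp.mat (symplecticTransvection u w huw) *ᵥ v =
      v + stdSymplecticForm n v u • w + stdSymplecticForm n v w • u := by
  rw [symplecticTransvection, GSp.mat_ofLinear_mulVec]
  simp

lemma mat_symplecticTransvection_apply (u w : Fin n ⊕ Fin n → ℂ)
    (huw : stdSymplecticForm n u w = 0) (x y : Fin n ⊕ Fin n) :
    GSp.mat (symplecticTransvection u w huw) x y = (Pi.single y 1 : Fin n ⊕ Fin n → ℂ) x +
      stdSymplecticForm n (Pi.single y 1) u * w x +
      stdSymplecticForm n (Pi.single y 1) w * u x := by
  have h := congrFun (mat_symplecticTransvection_mulVec u w huw (Pi.single y 1)) x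
  rwa [Matrix.mulVec_single_one] at h

lemma GSp.ext_mulVec {g h : GSp n} (H : ∀ v, GSp.mat g *ᵥ v = GSp.mat h *ᵥ v) : g = h :=
  GSp.mat_injective (Matrix.ext_of_mulVec_single fun _ => H _)

lemma commute_symplecticTransvection {u w : Fin n ⊕ Fin n → ℂ}
    (huw : stdSymplecticForm n u w = 0) {g : GSp n} {c : ℂˣ} (hg : GSp.HasSimilitude g c) {α β : ℂ}
    (hu : GSp.mat g *ᵥ u = α • u) (hw : GSp.mat g *ᵥ w = β • w) (hαβ : α * β = c) :
    Commute g (symplecticTransvection u w huw) := by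
  have hα : α ≠ 0 := left_ne_zero_of_mul (hαβ ▸ c.ne_zero)
  have hβ : β ≠ 0 := right_ne_zero_of_mul (hαβ ▸ c.ne_zero)
  refine GSp.ext_mulVec fun v => ?_
  rw [GSp.mat_mul, GSp.mat_mul, ← Matrix.mulVec_mulVec, ← Matrix.mulVec_mulVec,
    mat_symplecticTransvection_mulVec, mat_symplecticTransvection_mulVec, Matrix.mulVec_add,
    Matrix.mulVec_add, Matrix.mulVec_smul, Matrix.mulVec_smul, hu, hw]
  have h1 : stdSymplecticForm n (GSp.mat g *ᵥ v) u = β * stdSymplecticForm n v u := by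
    have := hg v u
    rw [hu, map_smul, smul_eq_mul, ← hαβ] at this
    apply mul_left_cancel₀ hα
    rw [this, mul_assoc]
  have h2 : stdSymplecticForm n (GSp.mat g *ᵥ v) w = α * stdSymplecticForm n v w := by
    have := hg v w
    rw [hw, map_smul, smul_eq_mul, ← hαβ] at this
    apply mul_left_cancel₀ hβ
    rw [this]
    ring
  rw [h1, h2, smul_smul, smul_smul, mul_comm β, mul_comm α]

/-- An element of `GSp_{2n}(ℂ)` commuting with the diagonal torus is diagonal. -/
lemma isDiag_of_commute_diagGSp {g : GSp n} (hg : ∀ p, Commute (diagGSp p) g) :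
    (GSp.mat g).IsDiag := by
  intro x y hxy
  -- an element of the torus whose entry at `x` occurs nowhere else
  let p : ℂ × (Fin n ⊕ Fin n → ℂ) := (0, Pi.single x 1)
  have hx : diagExponent p x = (1 : ℝ) := by
    rcases x with i | i <;> simp [diagExponent, p]
  obtain ⟨a, ha, hy⟩ : ∃ a : ℝ, a ≠ 1 ∧ diagExponent p y = a := by
    by_cases h : y.swap = x
    · exact ⟨-1, by norm_num, by simp [diagExponent, p, h, hxy.symm]⟩
    · exact ⟨0, by norm_num, by simp [diagExponent, p, h, hxy.symm]⟩
  have h1 := congrFun (congrFun (congrArg GSp.mat (hg p).eq) x) y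
  rw [GSp.mat_mul, GSp.mat_mul, mat_diagGSp, Matrix.diagonal_mul, Matrix.mul_diagonal, hx, hy,
    ← Complex.ofReal_exp, ← Complex.ofReal_exp, mul_comm, ← sub_eq_zero, ← mul_sub] at h1
  refine (mul_eq_zero.mp h1).resolve_right (sub_ne_zero.mpr fun h => ha ?_)
  exact (Real.exp_injective (Complex.ofReal_injective h)).symm

lemma commute_of_mem_diagonalSubgroup {Q g h : GSp n} (hg : g ∈ diagonalSubgroup Q)
    (hh : h ∈ diagonalSubgroup Q) : Commute g h := by
  have h1 : Commute (Q⁻¹ * g * Q) (Q⁻¹ * h * Q) := GSp.mat_injective (by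
    rw [GSp.mat_mul (Q⁻¹ * g * Q), GSp.mat_mul (Q⁻¹ * h * Q), ← (mem_diagonalSubgroup.mp hg).diagonal_diag,
      ← (mem_diagonalSubgroup.mp hh).diagonal_diag, Matrix.diagonal_mul_diagonal,
      Matrix.diagonal_mul_diagonal]
    simp only [mul_comm])
  have h2 := (Commute.conj_iff Q).mpr h1
  simpa [mul_assoc] using h2

end Transvections

/-! ### Sets centralized by exactly a diagonal torus -/

section DiagonalCentralizers

variable {n : ℕ} {X : Set (GSp n)} {Q : GSp n}

/-- A set whose centralizer is a diagonal torus lies in that torus, because the torus is its own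
centralizer. Thus no commutativity of `X` has to be assumed. -/
lemma subset_diagonalSubgroup (hX : Subgroup.centralizer X = diagonalSubgroup Q) :
    X ⊆ diagonalSubgroup Q := by
  intro g hg
  apply isDiag_of_commute_diagGSp
  intro p
  have hp : Q * diagGSp p * Q⁻¹ ∈ Subgroup.centralizer X := by
    rw [hX, mem_diagonalSubgroup]
    have e : Q⁻¹ * (Q * diagGSp p * Q⁻¹) * Q = diagGSp p := by group
    rw [e]
    exact Matrix.isDiag_diagonal _
  have h1 : Commute g (Q * diagGSp p * Q⁻¹) := Subgroup.mem_centralizer_iff.mp hp g hg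
  have h2 := (Commute.conj_iff Q⁻¹).mpr h1.symm
  simpa [mul_assoc] using h2

lemma mulVec_single_of_isDiag {g : GSp n} (hg : (GSp.mat g).IsDiag) (x : Fin n ⊕ Fin n) :
    GSp.mat g *ᵥ Pi.single x 1 = GSp.mat g x x • Pi.single x 1 := by
  ext y
  rw [Matrix.mulVec_single_one]
  by_cases hyx : y = x
  · simp [hyx]
  · simpa [hyx] using hg hyx

lemma mul_diag_swap {g : GSp n} {c : ℂˣ} (hc : GSp.HasSimilitude g c) (hg : (GSp.mat g).IsDiag)
    (x : Fin n ⊕ Fin n) : GSp.mat g x x * GSp.mat g x.swap x.swap = c := by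
  have h := hc (Pi.single x 1) (Pi.single x.swap 1)
  rw [mulVec_single_of_isDiag hg, mulVec_single_of_isDiag hg] at h
  have hJ : stdSymplecticForm n (Pi.single x 1) (Pi.single x.swap 1) ≠ 0 := by
    rw [stdSymplecticForm_single]; exact (J_ne_zero_iff _ _).mpr rfl
  apply mul_right_cancel₀ hJ
  rw [← h]
  simp only [map_smul, LinearMap.smul_apply, smul_eq_mul]
  ring

/-- If the centralizer of `X` is a diagonal torus, then the diagonal entries are pairwise different
functions on `X`: otherwise a transvection would centralize `X`. -/
lemma exists_diag_ne (hX : Subgroup.centralizer X = diagonalSubgroup Q) {x y : Fin n ⊕ Fin n}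
    (hxy : x ≠ y) :
    ∃ g ∈ X, GSp.mat (Q⁻¹ * g * Q) x x ≠ GSp.mat (Q⁻¹ * g * Q) y y := by
  by_contra! hcon
  have hswap : y.swap ≠ x.swap := fun h => hxy (by
    rw [← Sum.swap_swap x, ← h, Sum.swap_swap])
  have h0 : stdSymplecticForm n (Pi.single x 1) (Pi.single y.swap 1) = 0 := by
    rw [stdSymplecticForm_single]
    by_contra h
    exact hswap ((J_ne_zero_iff _ _).mp h)
  set t := symplecticTransvection _ _ h0 with ht
  have hmem : Q * t * Q⁻¹ ∈ Subgroup.centralizer X := by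
    rw [Subgroup.mem_centralizer_iff]
    intro g hg
    have hd := mem_diagonalSubgroup.mp (subset_diagonalSubgroup hX hg)
    obtain ⟨c, hc⟩ := (Q⁻¹ * g * Q).2
    have h1 : Commute (Q⁻¹ * g * Q) t :=
      commute_symplecticTransvection h0 (c := c) hc (mulVec_single_of_isDiag hd x)
        (mulVec_single_of_isDiag hd y.swap) (by rw [hcon g hg]; exact mul_diag_swap hc hd y)
    have h2 := (Commute.conj_iff Q).mpr h1
    have e : Q * (Q⁻¹ * g * Q) * Q⁻¹ = g := by group
    rw [e] at h2
    exact h2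
  rw [hX, mem_diagonalSubgroup] at hmem
  have e : Q⁻¹ * (Q * t * Q⁻¹) * Q = t := by group
  rw [e] at hmem
  have h1 := hmem hswap
  rw [ht, mat_symplecticTransvection_apply] at h1
  have hJ : stdSymplecticForm n (Pi.single x.swap 1) (Pi.single x 1) ≠ 0 := by
    rw [stdSymplecticForm_single, J_ne_zero_iff, Sum.swap_swap]
  by_cases h : y.swap = x
  · simp only [h] at h1 hswap
    simp only [Pi.single_eq_same, Pi.single_eq_of_ne hswap, mul_one, zero_add] at h1
    rw [← two_mul] at h1
    exact mul_ne_zero two_ne_zero hJ h1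
  · simp [hswap, h] at h1
    exact hJ h1

/-- The diagonal entries of a central element at dual places coincide, since it commutes with the
transvection along one of the two places. -/
lemma exp_diagExponent_swap_eq {p : ℂ × (Fin n ⊕ Fin n → ℂ)}
    (hp : Q * diagGSp p * Q⁻¹ ∈ Subgroup.center (GSp n)) (x : Fin n ⊕ Fin n) :
    Complex.exp (diagExponent p x) = Complex.exp (diagExponent p x.swap) := by
  set t := symplecticTransvection (Pi.single x 1) (Pi.single x 1)
    (stdSymplecticForm_isAlt.self_eq_zero _) with ht
  have h1 : Commute (Q * diagGSp p * Q⁻¹) (Q * t * Q⁻¹) :=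
    (Subgroup.mem_center_iff.mp hp _).symm
  have h2 : Commute (diagGSp p) t := (Commute.conj_iff Q).mp h1
  have hne : x ≠ x.swap := by rcases x with i | i <;> simp
  have hJ : stdSymplecticForm n (Pi.single x.swap 1) (Pi.single x 1) ≠ 0 := by
    rw [stdSymplecticForm_single, J_ne_zero_iff, Sum.swap_swap]
  have h3 : GSp.mat t x x.swap ≠ 0 := by
    rw [ht, mat_symplecticTransvection_apply]
    simp only [Pi.single_eq_same, Pi.single_eq_of_ne hne, mul_one, zero_add]
    rw [← two_mul]
    exact mul_ne_zero two_ne_zero hJ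
  have h4 := congrFun (congrFun (congrArg GSp.mat h2.eq) x) x.swap
  rw [GSp.mat_mul, GSp.mat_mul, mat_diagGSp, Matrix.diagonal_mul, Matrix.mul_diagonal,
    mul_comm] at h4
  exact mul_left_cancel₀ h3 h4

/-- The basis of `ℂ^{2n}` formed by the columns of `Q`. -/
def columnBasis (Q : GSp n) : Module.Basis (Fin n ⊕ Fin n) ℂ (Fin n ⊕ Fin n → ℂ) :=
  (Pi.basisFun ℂ _).map (Matrix.toLin'OfInv (GSp.mat_inv_mul Q) (GSp.mat_mul_inv Q))

lemma columnBasis_apply (Q : GSp n) (x : Fin n ⊕ Fin n) :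
    columnBasis Q x = GSp.mat Q *ᵥ Pi.single x 1 := by
  simp [columnBasis, Matrix.toLin'OfInv]

lemma stdSymplecticForm_columnBasis_ne_zero_iff (Q : GSp n) (x y : Fin n ⊕ Fin n) :
    stdSymplecticForm n (columnBasis Q x) (columnBasis Q y) ≠ 0 ↔ y = x.swap := by
  obtain ⟨c, hc⟩ := Q.2
  have h := hc (Pi.single x 1) (Pi.single y 1)
  change stdSymplecticForm n (GSp.mat Q *ᵥ _) (GSp.mat Q *ᵥ _) = _ at h
  rw [columnBasis_apply, columnBasis_apply, h, stdSymplecticForm_single, ← J_ne_zero_iff]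
  simp

lemma mulVec_columnBasis {Q g : GSp n} (hg : g ∈ diagonalSubgroup Q) (x : Fin n ⊕ Fin n) :
    GSp.mat g *ᵥ columnBasis Q x = GSp.mat (Q⁻¹ * g * Q) x x • columnBasis Q x := by
  rw [columnBasis_apply, ← Matrix.mulVec_smul, ← mulVec_single_of_isDiag hg,
    Matrix.mulVec_mulVec, Matrix.mulVec_mulVec, ← GSp.mat_mul, ← GSp.mat_mul]
  congr 2
  group

end DiagonalCentralizers

/-! ### Parameters of the Weil group -/

section Parameters

variable {k kbar : Type*} [NontriviallyNormedField k] [IsUltrametricDist k]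
  [Field kbar] [Algebra k kbar] [IsAlgClosure k kbar] {F : Gal(kbar/k)} {n : ℕ}

namespace LanglandsParameter

/-- The representation of the Weil group on `ℂ^{2n}` given by a parameter. -/
def weilRep (φ : LanglandsParameter F n) :
    Representation ℂ (WeilGroup F) (Fin n ⊕ Fin n → ℂ) where
  toFun w := Matrix.toLin' (GSp.mat (φ.onWeil w))
  map_one' := by rw [map_one, GSp.mat_one, Matrix.toLin'_one]; rfl
  map_mul' v w := by rw [map_mul, GSp.mat_mul, Matrix.toLin'_mul]; rfl

lemma weilRep_apply (φ : LanglandsParameter F n) (w : WeilGroup F) (v : Fin n ⊕ Fin n → ℂ) :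
    φ.weilRep w v = GSp.mat (φ.onWeil w) *ᵥ v := rfl

lemma continuous_onWeil (φ : LanglandsParameter F n) : Continuous φ.onWeil :=
  φ.hom.continuous_toFun.comp (Continuous.prodMk_left 1)

/-- `SL₂(ℂ)` is perfect, so it is killed by a homomorphism to `GSp_{2n}(ℂ)` whose image commutes
with a set having abelian centralizer. -/
theorem hom_sl2_eq_one (φ : LanglandsParameter F n) {Q : GSp n} {X : Set (WeilGroup F)}
    (hX : Subgroup.centralizer (φ.onWeil '' X) = diagonalSubgroup Q)
    (g : Matrix.SpecialLinearGroup (Fin 2) ℂ) : φ.hom (1, g) = 1 := by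
  let ψ : Matrix.SpecialLinearGroup (Fin 2) ℂ →* GSp n :=
    φ.hom.toMonoidHom.comp (MonoidHom.inr _ _)
  have hψ : ∀ g, ψ g ∈ diagonalSubgroup Q := by
    intro g
    rw [← hX, Subgroup.mem_centralizer_iff]
    rintro _ ⟨w, -, rfl⟩
    change φ.hom (w, 1) * φ.hom (1, g) = φ.hom (1, g) * φ.hom (w, 1)
    rw [← map_mul, ← map_mul]
    simp
  have hker : commutator (Matrix.SpecialLinearGroup (Fin 2) ℂ) ≤ ψ.ker := by
    rw [commutator_def, Subgroup.commutator_le]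
    intro g _ h _
    rw [MonoidHom.mem_ker, map_commutatorElement, commutatorElement_eq_one_iff_commute]
    exact commute_of_mem_diagonalSubgroup (hψ g) (hψ h)
  rw [Matrix.SL2.commutator_eq_top (a := (2 : ℂ)) two_ne_zero (by norm_num)] at hker
  exact hker (Subgroup.mem_top g)

/-- A permutation induced by Frobenius on the eigenlines of inertia of a discrete series parameter
connects each line to the dual one: otherwise, scaling the lines of an orbit by `z` and those of
the dual orbit by `z⁻¹` would be a connected group of noncentral elements centralizing `φ`. -/
theorem IsDiscreteSeries.sameCycle_swap {φ : LanglandsParameter F n} (hds : φ.IsDiscreteSeries)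
    {Q : GSp n}
    (hQ : ∀ w ∈ WeilGroup.inertia F, φ.onWeil w ∈ diagonalSubgroup Q)
    {σ : Equiv.Perm (Fin n ⊕ Fin n)} {a : Fin n ⊕ Fin n → ℂ}
    (hσ : ∀ x, φ.weilRep (WeilGroup.frob F) (columnBasis Q x) = a x • columnBasis Q (σ x))
    (hcomm : ∀ x, σ x.swap = (σ x).swap) (x : Fin n ⊕ Fin n) : σ.SameCycle x x.swap := by
  classical
  by_contra hx
  let u : Fin n ⊕ Fin n → ℂ := fun y => if σ.SameCycle x y then 1 else 0
  have hu : ∀ y, u (σ y) = u y := fun y => by simp [u, Equiv.Perm.sameCycle_apply_right]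
  let γ : ℂ → GSp n := fun z => Q * diagGSp (0, z • u) * Q⁻¹
  have hγ : Continuous γ := by
    have h1 : Continuous fun z : ℂ => ((0 : ℂ), z • u) := by fun_prop
    exact (continuous_const.mul (continuous_diagGSp.comp h1)).mul continuous_const
  have hγe : ∀ z, Q⁻¹ * γ z * Q = diagGSp (0, z • u) := fun z => by simp only [γ]; group
  have hγQ : ∀ z, γ z ∈ diagonalSubgroup Q := fun z => by
    rw [mem_diagonalSubgroup, hγe]; exact Matrix.isDiag_diagonal _
  have hγb : ∀ z y, GSp.mat (γ z) *ᵥ columnBasis Q y =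
      Complex.exp (diagExponent (0, z • u) y) • columnBasis Q y := fun z y => by
    rw [mulVec_columnBasis (hγQ z), hγe, mat_diagGSp, Matrix.diagonal_apply_eq]
  have hγφ : ∀ z w, Commute (γ z) (φ.onWeil w) := by
    intro z w
    have hle : WeilGroup.inertia F ⊔ Subgroup.zpowers (WeilGroup.frob F) ≤
        (Subgroup.centralizer {γ z}).comap φ.onWeil := by
      rw [sup_le_iff, Subgroup.zpowers_le]
      constructor
      · intro v hv
        rw [Subgroup.mem_comap, Subgroup.mem_centralizer_singleton_iff]
        exact commute_of_mem_diagonalSubgroup (hQ v hv) (hγQ z)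
      · rw [Subgroup.mem_comap, Subgroup.mem_centralizer_singleton_iff]
        have hlin : Matrix.toLin' (GSp.mat (φ.onWeil (WeilGroup.frob F) * γ z)) =
            Matrix.toLin' (GSp.mat (γ z * φ.onWeil (WeilGroup.frob F))) := by
          refine (columnBasis Q).ext fun y => ?_
          have hexp : diagExponent (0, z • u) (σ y) = diagExponent (0, z • u) y := by
            simp [diagExponent, ← hcomm, hu]
          have hσy := hσ y
          rw [weilRep_apply] at hσy
          rw [Matrix.toLin'_apply, Matrix.toLin'_apply, GSp.mat_mul _ (γ z),
            GSp.mat_mul (γ z), ← Matrix.mulVec_mulVec, ← Matrix.mulVec_mulVec, hγb, Matrix.mulVec_smul, hσy,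
            Matrix.mulVec_smul, hγb, hexp, smul_comm]
        exact GSp.mat_injective (Matrix.toLin'.injective hlin)
    rw [WeilGroup.inertia_sup_frob] at hle
    have := hle (Subgroup.mem_top w)
    rw [Subgroup.mem_comap, Subgroup.mem_centralizer_singleton_iff] at this
    exact this.symm
  have hγ0 : γ 0 = 1 := by
    have h1 : diagGSp (0, (0 : ℂ) • u) = 1 := GSp.mat_injective (by
      rw [mat_diagGSp]; simp [diagExponent])
    simp only [γ]
    rw [h1]
    group
  have hsub : Set.range γ ⊆ connectedComponentIn
      (Subgroup.centralizer (Set.range φ.onWeil) : Set (GSp n)) 1 := by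
    refine (isConnected_range hγ).isPreconnected.subset_connectedComponentIn ⟨0, hγ0⟩ ?_
    rintro _ ⟨z, rfl⟩
    rw [SetLike.mem_coe, Subgroup.mem_centralizer_iff]
    rintro _ ⟨w, rfl⟩
    exact (hγφ z w).symm
  have hcenter : γ 1 ∈ Subgroup.center (GSp n) := by
    have h1 := hsub ⟨1, rfl⟩
    rw [hds] at h1
    exact connectedComponentIn_subset _ _ h1
  have h1 := exp_diagExponent_swap_eq hcenter x
  have h2 : diagExponent (0, (1 : ℂ) • u) x = (1 : ℝ) := by
    simp [diagExponent, u, hx, Equiv.Perm.SameCycle.refl]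
  have h3 : diagExponent (0, (1 : ℂ) • u) x.swap = (-1 : ℝ) := by
    simp [diagExponent, u, hx, Equiv.Perm.SameCycle.refl]
  rw [h2, h3, ← Complex.ofReal_exp, ← Complex.ofReal_exp] at h1
  have h4 := Real.exp_injective (Complex.ofReal_injective h1)
  norm_num at h4

/-- A character by which a subgroup of the Weil group acts on a line of `ℂ^{2n}` is continuous. -/
lemma continuous_of_weilRep_eq_smul (φ : LanglandsParameter F n) {H : Subgroup (WeilGroup F)}
    {η : H →* ℂˣ} {v : Fin n ⊕ Fin n → ℂ} (hv : v ≠ 0)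
    (hη : ∀ h : H, φ.weilRep h v = (η h : ℂ) • v) : Continuous η := by
  obtain ⟨y, hy⟩ := Function.ne_iff.mp hv
  have hval : ∀ h : H, (η h : ℂ) = (GSp.mat (φ.onWeil h) *ᵥ v) y / v y := fun h => by
    rw [← weilRep_apply, hη, Pi.smul_apply, smul_eq_mul, mul_div_cancel_right₀ _ hy]
  have hcont : Continuous fun h : H => φ.onWeil h :=
    φ.continuous_onWeil.comp continuous_subtype_val
  refine Units.continuous_iff.mpr ⟨?_, ?_⟩
  · simp only [Function.comp_def, hval]
    exact ((continuous_apply y).comp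
      ((GSp.continuous_mat.comp hcont).matrix_mulVec continuous_const)).div_const _
  · simp only [← map_inv, hval, Subgroup.coe_inv]
    simp only [map_inv]
    exact ((continuous_apply y).comp
      ((GSp.continuous_mat.comp hcont.inv).matrix_mulVec continuous_const)).div_const _

end LanglandsParameter

end Parameters

end

theorem lemma3p3 {k kbar : Type*} [NontriviallyNormedField k] [IsUltrametricDist k]
    [LocallyCompactSpace k] [CharZero k] [Field kbar] [Algebra k kbar] [IsAlgClosure k kbar]
    (F : Gal(kbar/k)) (hF : IsGeometricFrobenius F) (n : ℕ)
    (lam : WeilGroup F →* ℂˣ) (φ : LanglandsParameter F n)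
    (hsim : φ.HasSimilitudeCharacter lam)
    (htame : φ.IsTame) (hreg : φ.IsRegular) (hds : φ.IsDiscreteSeries) :
    -- `φ` factors through `W_k`
    (∀ g : Matrix.SpecialLinearGroup (Fin 2) ℂ, φ.hom (1, g) = 1) ∧
    ∃ (s : ℕ) (d : Fin s → ℕ) (η : ∀ i, WeilGroup.unramified F (2 * d i) →ₜ* ℂˣ),
      (∀ i, 0 < d i) ∧ ∑ i, d i = n ∧
      (∀ i, IsAdmissibleCharacter lam (d i) (η i)) ∧
      -- each `V(η_i)` is tame and irreducible
      (∀ i, ∀ w ∈ WeilGroup.wildInertia F, indRep (η i).toMonoidHom w = 1) ∧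
      (∀ i, (indRep (η i).toMonoidHom).IsIrreducible) ∧
      -- if `d_i = d_j` with `i ≠ j`, then `η_i` is not a Frobenius conjugate of `η_j`
      (∀ i j, i ≠ j → d i = d j → ∀ m : ℕ,
        ∃ (w : WeilGroup F) (hi : w ∈ WeilGroup.unramified F (2 * d i))
          (hj : w ∈ WeilGroup.unramified F (2 * d j)),
          η i ⟨w, hi⟩ ≠ conjChar (WeilGroup.frob F ^ m) (η j).toMonoidHom ⟨w, hj⟩) ∧
      -- the `V(η_i)` are pairwise non-isomorphic
      (∀ i j, i ≠ j →
        IsEmpty ((indRep (η i).toMonoidHom).Equiv (indRep (η j).toMonoidHom))) ∧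
      -- the `V(η_i)` are symplectic with similitude character `lam`, and `φ` is their direct sum,
      -- as a representation of `W_k` on a symplectic space
      ∃ B : ∀ i, LinearMap.BilinForm ℂ (IndSpace (η i).toMonoidHom),
        (∀ i, IsSymplecticFormFor (indRep (η i).toMonoidHom) lam (B i)) ∧
        ∃ e : (∀ i, IndSpace (η i).toMonoidHom) ≃ₗ[ℂ] (Fin n ⊕ Fin n → ℂ),
          (∀ (w : WeilGroup F) (x : ∀ i, IndSpace (η i).toMonoidHom),
            e (fun i => indRep (η i).toMonoidHom w (x i)) = GSp.mat (φ.onWeil w) *ᵥ e x) ∧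
          (∀ x y : ∀ i, IndSpace (η i).toMonoidHom,
            stdSymplecticForm n (e x) (e y) = ∑ i, B i (x i) (y i)) := by
  obtain ⟨Q, hQ⟩ := IsMaximalTorus.exists_eq_diagonalSubgroup hreg
  have hI : ∀ w ∈ WeilGroup.inertia F, φ.onWeil w ∈ diagonalSubgroup Q := fun w hw =>
    subset_diagonalSubgroup hQ ⟨w, hw, rfl⟩
  obtain ⟨s, d, v, η, hd, hsum, hv, hη, hdist, hmul, hfrob, hirr, hnconj, hniso, B, hB, e, he,
    hform⟩ := exists_symplectic_decomposition (ρ := φ.weilRep) (WeilGroup.inertia_sup_frob F)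
    (WeilGroup.unramified F) (fun _ => rfl) (columnBasis Q)
    (θ := fun x w => GSp.mat (Q⁻¹ * φ.onWeil w * Q) x x)
    (fun w hw x => mulVec_columnBasis (hI w hw) x)
    (fun x y hxy => by
      obtain ⟨_, ⟨w, hw, rfl⟩, h⟩ := exists_diag_ne hQ hxy
      exact ⟨w, hw, h⟩)
    (stdSymplecticForm_isAlt (n := n)) stdSymplecticForm_separating (lam := lam) hsim
    (τ := Sum.swap) (stdSymplecticForm_columnBasis_ne_zero_iff Q)
    (fun σ a hσ hcomm x => hds.sameCycle_swap hI hσ hcomm x)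
  have hv0 : ∀ i, v i ≠ 0 := fun i => by
    obtain ⟨x, hx⟩ := hv i
    rw [hx]
    exact (columnBasis Q).ne_zero x
  refine ⟨φ.hom_sl2_eq_one hQ, s, d,
    fun i => ⟨η i, φ.continuous_of_weilRep_eq_smul (hv0 i) (hη i)⟩, hd, ?_,
    fun i => ⟨?_, hdist i, hmul i, hfrob i _⟩, ?_, hirr, fun i j hij _ => hnconj i j hij, hniso,
    B, hB, e, he, hform⟩
  · rw [Fintype.card_sum, Fintype.card_fin] at hsum
    omega
  · intro w hw
    have h := hη i w
    rw [LanglandsParameter.weilRep_apply, htame _ hw, GSp.mat_one, Matrix.one_mulVec] at h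
    apply Units.ext
    apply smul_left_injective ℂ (hv0 i)
    change (η i w : ℂ) • v i = ((1 : ℂˣ) : ℂ) • v i
    rw [Units.val_one, one_smul, ← h]
  · intro i w hw
    refine LinearMap.ext fun x => Pi.single_injective i (e.injective ?_)
    have h := he w (Pi.single i x)
    rw [LanglandsParameter.weilRep_apply, htame _ hw, GSp.mat_one, Matrix.one_mulVec] at h
    rw [Module.End.one_apply, ← h]
    congr 1
    ext1 j
    exact (Pi.apply_single (fun j => indRep (η j) w) (fun j => map_zero _) i x j).symm
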